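/- Let $n\ge 1$ and let $P_n$ be the one-sided transposition shuffle, the probability distribution on the symmetric group $S_n$ obtained by giving weight $\frac1n\cdot\frac1j$ to the transposition $(i\,j)$ for each pair $1\le i\le j\le n$, where every $(i\,i)$ denotes the identity (so $P_n(\mathrm{id})=\frac1n\sum_{j=1}^n\frac1j$). Regard $P_n$ as the linear operator on the group algebra $\mathbb{C}[S_n]$ given by left multiplication by $\sum_{\sigma\in S_n}P_n(\sigma)\,\sigma=\sum_{1\le i\le j\le n}\frac{1}{nj}(i\,j)$. For a partition $\lambda\vdash n$ let $\mathrm{SYT}(\lambda)$ be the set of standard Young tableaux of shape $\lambda$ (fillings of the boxes of $\lambda$ with $1,\dots,n$, each used once, increasing along rows and down columns), and let $d_\lambda=|\mathrm{SYT}(\lambda)|$. To $T\in\mathrm{SYT}(\lambda)$ attach the number $$\mathrm{eig}(T)=\frac1n\sum_{(i,j)}\frac{j-i+1}{T(i,j)},$$ the sum being over all boxes $(i,j)$ (row $i$, column $j$) of $\lambda$. Then the eigenvalues of $P_n$ are labelled by the standard Young tableaux of size $n$, and the eigenvalue labelled by a tableau of shape $\lambda$ appears $d_\lambda$ times. That is: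 a complex number is an eigenvalue of $P_n$ if and only if it equals $\mathrm{eig}(T)$ for some standard Young tableau $T$ of size $n$; the multiset of the $n!$ roots of the characteristic polynomial of $P_n$ consists of $d_\lambda$ copies of $\mathrm{eig}(T)$ for each $\lambda\vdash n$ and each $T\in\mathrm{SYT}(\lambda)$, where the contributions of different tableaux with the same value $\mathrm{eig}(T)$ are added; and for every $\beta\in\mathbb{C}$ the $\beta$-eigenspace of $P_n$ has dimension $\sum_{T:\,\mathrm{eig}(T)=\beta}d_{\mathrm{shape}(T)}$, the sum being over the standard Young tableaux $T$ of size $n$. -/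

import Mathlib

namespace OneSidedShuffle

noncomputable section

/-- A standard Young tableau of shape `μ`: the boxes of `μ` are filled with `1, …, |μ|`, each used
exactly once, increasing along rows and down columns. As for Mathlib's semistandard tableaux, a
filling is a function `ℕ → ℕ → ℕ` that vanishes outside `μ`; rows and columns are numbered from
`0`, whereas the entries are numbered from `1`. -/
@[ext]
structure SYT (μ : YoungDiagram) where
  /-- `entry i j` is the entry of the box in row `i` and column `j`. -/
  entry : ℕ → ℕ → ℕ
  row_strict : ∀ {i j₁ j₂ : ℕ}, j₁ < j₂ → (i, j₂) ∈ μ → entry i j₁ < entry i j₂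
  col_strict : ∀ {i₁ i₂ j : ℕ}, i₁ < i₂ → (i₂, j) ∈ μ → entry i₁ j < entry i₂ j
  zeros : ∀ {i j : ℕ}, (i, j) ∉ μ → entry i j = 0
  bijOn : Set.BijOn (fun c : ℕ × ℕ => entry c.1 c.2) (μ.cells : Set (ℕ × ℕ)) (Set.Icc 1 μ.card)

/-- The partitions of `n`, as Young diagrams with `n` boxes. -/
abbrev Shape (n : ℕ) : Type := {μ : YoungDiagram // μ.card = n}

instance finite_SYT (μ : YoungDiagram) : Finite (SYT μ) := by
  refine Finite.of_injective
    (fun T : SYT μ => fun c : μ.cells =>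
      (⟨T.entry c.1.1 c.1.2, (T.bijOn.mapsTo c.2).2⟩ : Set.Iic μ.card)) ?_
  intro T S h
  ext i j
  by_cases hc : (i, j) ∈ μ
  · exact congrArg Subtype.val (congrFun h ⟨(i, j), hc⟩)
  · rw [T.zeros hc, S.zeros hc]

instance finite_Shape (n : ℕ) : Finite (Shape n) := by
  have key : ∀ μ : Shape n, μ.1.cells ⊆ Finset.range n ×ˢ Finset.range n := by
    rintro ⟨μ, rfl⟩ ⟨i, j⟩ hc
    have hc' : (i, j) ∈ μ := hc
    have h1 : j < μ.rowLen i := YoungDiagram.mem_iff_lt_rowLen.1 hc'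
    have h2 : i < μ.colLen j := YoungDiagram.mem_iff_lt_colLen.1 hc'
    rw [YoungDiagram.rowLen_eq_card] at h1
    rw [YoungDiagram.colLen_eq_card] at h2
    have h3 : (μ.row i).card ≤ μ.card := Finset.card_le_card (Finset.filter_subset _ _)
    have h4 : (μ.col j).card ≤ μ.card := Finset.card_le_card (Finset.filter_subset _ _)
    simp only [Finset.mem_product, Finset.mem_range]
    exact ⟨by omega, by omega⟩
  refine Finite.of_injective
    (fun μ : Shape n => (⟨μ.1.cells, Finset.mem_powerset.2 (key μ)⟩ :
      (Finset.range n ×ˢ Finset.range n).powerset)) ?_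
  intro μ ν h
  exact Subtype.ext (YoungDiagram.ext (congrArg Subtype.val h))

/-- The standard Young tableaux of size `n`: pairs of a shape with `n` boxes and a standard Young
tableau of that shape. -/
abbrev Tableau (n : ℕ) : Type := Σ μ : Shape n, SYT μ.1

instance fintype_Tableau (n : ℕ) : Fintype (Tableau n) := Fintype.ofFinite _

/-- The dimension `d_μ`: the number of standard Young tableaux of shape `μ`. -/
def dim (μ : YoungDiagram) : ℕ := Nat.card (SYT μ)

/-- The eigenvalue represented by the tableau `T` of shape `μ`, `|μ| = n`:
`(1 / n) ∑ (j - i + 1) / T(i, j)`, summed over the boxes `(i, j)` of `T`. (The difference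
`j - i` does not depend on whether rows and columns are numbered from `0` or from `1`.) -/
def eig {μ : YoungDiagram} (T : SYT μ) : ℝ :=
  (1 / (μ.card : ℝ)) * ∑ c ∈ μ.cells, ((c.2 : ℝ) - (c.1 : ℝ) + 1) / (T.entry c.1 c.2 : ℝ)

/-- The one-sided transposition shuffle distribution on `S_n`. Positions are numbered from `0`, so
the pair `i ≤ j` has probability `1 / (n (j + 1))`; a transposition `(i j)` with `i < j` comes from
exactly one pair, and all the pairs `(i, i)` contribute to the identity. -/
def shuffle (n : ℕ) (σ : Equiv.Perm (Fin n)) : ℝ :=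
  ∑ j : Fin n, ∑ i ∈ Finset.Iic j,
    if Equiv.swap i j = σ then 1 / (n : ℝ) * (1 / ((j : ℕ) + 1 : ℝ)) else 0

/-- The shuffle as an element of the complex group algebra of `S_n`. -/
def shuffleElement (n : ℕ) : MonoidAlgebra ℂ (Equiv.Perm (Fin n)) :=
  ∑ σ : Equiv.Perm (Fin n), MonoidAlgebra.single σ ((shuffle n σ : ℝ) : ℂ)

/-- The shuffle as a linear operator on the regular module: left multiplication by its element of
the group algebra. -/
def shuffleOperator (n : ℕ) :
    Module.End ℂ (MonoidAlgebra ℂ (Equiv.Perm (Fin n))) :=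
  LinearMap.mulLeft ℂ (shuffleElement n)

end

end OneSidedShuffle

/-! Grouping the pairs by their larger index writes the shuffle as a combination of the Jucys–Murphy
elements, `∑ (J_k + 1) / (n (k + 1))` (`shuffleElement_eq_sum`). A joint eigenvector of left
multiplication by the `J_k`, with the contents of a tableau `T` as eigenvalues, is therefore an
eigenvector of the shuffle, with eigenvalue `eig T`. It suffices to find a basis of the group
algebra indexed by pairs `(T, S)` of the same shape, on which the `J_k` act by the contents of `T`
from the left and of `S` from the right; each `T` then occurs `d_λ` times.

No representation theory of `S_n` is assumed. For the column-reading tableau of a shape, products of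
Vandermonde determinants over its columns give left and right eigenvectors `u`, `v`; the eigenvalue
equation is Lagrange interpolation (`sum_vandermonde_mul_vandermonde`). The product `u * v` is
nonzero because its coefficient at the identity is a sum of integer squares. Intertwiners
(`intertwine`) carry this vector to all other pairs (`SYT.exists_isBiweight`).

Contents determine a tableau, so vectors of different pairs have different joint eigenvalues and are
independent. They span because `∑ d_λ ^ 2 = n!` (`sum_dim_sq`), which follows from counting covers
in Young's lattice. -/

namespace OneSidedShuffle

noncomputable section

/-! ### Young's lattice and the identity `∑ d_λ ^ 2 = n!` -/

section YoungLattice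

open scoped Classical

instance fintypeShape (n : ℕ) : Fintype (Shape n) := Fintype.ofFinite _

instance fintypeSYT (μ : YoungDiagram) : Fintype (SYT μ) := Fintype.ofFinite _

theorem card_le_card_of_le {μ ν : YoungDiagram} (h : μ ≤ ν) : μ.card ≤ ν.card :=
  Finset.card_le_card (YoungDiagram.cells_subset_iff.2 h)

theorem eq_of_le_of_card_le {μ ν : YoungDiagram} (h : μ ≤ ν) (hc : ν.card ≤ μ.card) : μ = ν :=
  YoungDiagram.ext (Finset.eq_of_subset_of_card_le (YoungDiagram.cells_subset_iff.2 h) hc)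

theorem card_sup_add_card_inf (μ ν : YoungDiagram) :
    (μ ⊔ ν).card + (μ ⊓ ν).card = μ.card + ν.card := by
  simp only [YoungDiagram.card, YoungDiagram.cells_sup, YoungDiagram.cells_inf]
  exact Finset.card_union_add_card_inter _ _

/-- A standard tableau on a diagram with one box less, extended by the largest entry. -/
def SYT.extend {n : ℕ} {μ ν : YoungDiagram} (hμ : μ.card = n) (hν : ν.card = n + 1) (h : μ ≤ ν)
    (T : SYT μ) : SYT ν where
  entry i j := if (i, j) ∈ μ then T.entry i j else if (i, j) ∈ ν then n + 1 else 0
  row_strict := by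
    intro i j₁ j₂ hj hm
    have h1 : (i, j₁) ∈ ν := ν.up_left_mem le_rfl hj.le hm
    by_cases h2 : (i, j₂) ∈ μ
    · have h3 : (i, j₁) ∈ μ := μ.up_left_mem le_rfl hj.le h2
      simpa [h2, h3] using T.row_strict hj h2
    · by_cases h3 : (i, j₁) ∈ μ
      · have := (T.bijOn.mapsTo h3).2
        simp only [h3, h2, hm, if_true, if_false]
        simp only at this
        omega
      -- Two boxes of a row outside `μ` would make `ν` larger than `μ` by at least two.
      · exfalso
        have hsub : insert (i, j₁) (insert (i, j₂) μ.cells) ⊆ ν.cells := by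
          intro c hc
          simp only [Finset.mem_insert] at hc
          rcases hc with rfl | rfl | hc
          · exact h1
          · exact hm
          · exact h hc
        have hc := Finset.card_le_card hsub
        rw [Finset.card_insert_of_notMem, Finset.card_insert_of_notMem] at hc
        · change μ.card + 1 + 1 ≤ ν.card at hc
          omega
        · exact h2
        · simp only [Finset.mem_insert, not_or, YoungDiagram.mem_cells, Prod.mk.injEq]
          exact ⟨by omega, h3⟩
  col_strict := by
    intro i₁ i₂ j hi hm
    have h1 : (i₁, j) ∈ ν := ν.up_left_mem hi.le le_rfl hm
    by_cases h2 : (i₂, j) ∈ μ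
    · have h3 : (i₁, j) ∈ μ := μ.up_left_mem hi.le le_rfl h2
      simpa [h2, h3] using T.col_strict hi h2
    · by_cases h3 : (i₁, j) ∈ μ
      · have := (T.bijOn.mapsTo h3).2
        simp only [h3, h2, hm, if_true, if_false]
        simp only at this
        omega
      · exfalso
        have hsub : insert (i₁, j) (insert (i₂, j) μ.cells) ⊆ ν.cells := by
          intro c hc
          simp only [Finset.mem_insert] at hc
          rcases hc with rfl | rfl | hc
          · exact h1
          · exact hm
          · exact h hc
        have hc := Finset.card_le_card hsub
        rw [Finset.card_insert_of_notMem, Finset.card_insert_of_notMem] at hc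
        · change μ.card + 1 + 1 ≤ ν.card at hc
          omega
        · exact h2
        · simp only [Finset.mem_insert, not_or, YoungDiagram.mem_cells, Prod.mk.injEq]
          exact ⟨by omega, h3⟩
  zeros := by
    intro i j hm
    have : (i, j) ∉ μ := fun h' => hm (h h')
    simp [hm, this]
  bijOn := by
    have hsub : μ.cells ⊆ ν.cells := YoungDiagram.cells_subset_iff.2 h
    have hd : (ν.cells \ μ.cells).card = 1 := by
      rw [Finset.card_sdiff_of_subset hsub]
      change ν.card - μ.card = 1
      omega
    obtain ⟨c, hc⟩ := Finset.card_eq_one.1 hd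
    have hcm : c ∈ ν.cells \ μ.cells := by rw [hc]; simp
    rw [Finset.mem_sdiff] at hcm
    have hν' : (ν.cells : Set (ℕ × ℕ)) = (μ.cells : Set (ℕ × ℕ)) ∪ {c} := by
      have : ν.cells = μ.cells ∪ {c} := by rw [← hc, Finset.union_sdiff_of_subset hsub]
      rw [this]; simp
    have hIcc : Set.Icc 1 ν.card = Set.Icc 1 μ.card ∪ {n + 1} := by
      ext k; simp only [Set.mem_Icc, Set.mem_union, Set.mem_singleton_iff]; omega
    have h1 : Set.BijOn (fun c : ℕ × ℕ => if (c.1, c.2) ∈ μ then T.entry c.1 c.2 else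
        if (c.1, c.2) ∈ ν then n + 1 else 0) μ.cells (Set.Icc 1 μ.card) := by
      refine T.bijOn.congr ?_
      intro c hc
      have : (c.1, c.2) ∈ μ := hc
      simp [this]
    have hcval : (if (c.1, c.2) ∈ μ then T.entry c.1 c.2 else
        if (c.1, c.2) ∈ ν then n + 1 else 0) = n + 1 := by
      have a1 : (c.1, c.2) ∉ μ := hcm.2
      have a2 : (c.1, c.2) ∈ ν := hcm.1
      simp [a1, a2]
    have h2 : Set.BijOn (fun c : ℕ × ℕ => if (c.1, c.2) ∈ μ then T.entry c.1 c.2 else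
        if (c.1, c.2) ∈ ν then n + 1 else 0) {c} {n + 1} := by
      rw [Set.bijOn_singleton]; exact hcval
    rw [hν', hIcc]
    refine h1.union h2 ?_
    rintro a ha b hb hab
    simp only at hab
    rcases ha with ha | ha <;> rcases hb with hb | hb
    · exact h1.injOn ha hb hab
    · exfalso
      have := (h1.mapsTo ha).2
      rw [hab, Set.mem_singleton_iff.1 hb] at this
      simp only [hcval] at this
      omega
    · exfalso
      have := (h1.mapsTo hb).2
      rw [← hab, Set.mem_singleton_iff.1 ha] at this
      simp only [hcval] at this
      omega
    · rw [Set.mem_singleton_iff.1 ha, Set.mem_singleton_iff.1 hb]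

theorem SYT.mem_iff_extend_entry {n : ℕ} {μ ν : YoungDiagram} (hμ : μ.card = n)
    (hν : ν.card = n + 1) (h : μ ≤ ν) (T : SYT μ) (i j : ℕ) :
    (i, j) ∈ μ ↔ (i, j) ∈ ν ∧ (T.extend hμ hν h).entry i j ≤ n := by
  constructor
  · intro hm
    refine ⟨h hm, ?_⟩
    have := (T.bijOn.mapsTo hm).2
    simpa [SYT.extend, hm, ← hμ] using this
  · rintro ⟨h1, h2⟩
    by_contra h3
    simp [SYT.extend, h1, h3] at h2

/-- The boxes of a standard tableau with entries at most `n`. -/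
def SYT.initialShape {ν : YoungDiagram} (T : SYT ν) (n : ℕ) : YoungDiagram where
  cells := ν.cells.filter fun c => T.entry c.1 c.2 ≤ n
  isLowerSet := by
    rintro ⟨i, j⟩ ⟨i', j'⟩ hle hc
    obtain ⟨hi, hj⟩ : i' ≤ i ∧ j' ≤ j := hle
    simp only [Finset.coe_filter, Set.mem_ofPred_eq, YoungDiagram.mem_cells] at hc ⊢
    refine ⟨ν.up_left_mem hi hj hc.1, ?_⟩
    have h1 : T.entry i' j' ≤ T.entry i j' := by
      rcases hi.eq_or_lt with rfl | hi
      · exact le_rfl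
      · exact (T.col_strict hi (ν.up_left_mem le_rfl hj hc.1)).le
    have h2 : T.entry i j' ≤ T.entry i j := by
      rcases hj.eq_or_lt with rfl | hj
      · exact le_rfl
      · exact (T.row_strict hj hc.1).le
    omega

theorem SYT.mem_initialShape {ν : YoungDiagram} (T : SYT ν) (n i j : ℕ) :
    (i, j) ∈ T.initialShape n ↔ (i, j) ∈ ν ∧ T.entry i j ≤ n := by
  rw [← YoungDiagram.mem_cells]
  simp [SYT.initialShape]

theorem SYT.initialShape_bijOn {ν : YoungDiagram} (T : SYT ν) {n : ℕ} (hn : n ≤ ν.card) :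
    Set.BijOn (fun c : ℕ × ℕ => T.entry c.1 c.2) (T.initialShape n).cells (Set.Icc 1 n) := by
  refine ⟨?_, ?_, ?_⟩
  · rintro ⟨i, j⟩ hc
    have hc' := (T.mem_initialShape n i j).1 hc
    exact ⟨(T.bijOn.mapsTo hc'.1).1, hc'.2⟩
  · rintro ⟨i, j⟩ hc ⟨i', j'⟩ hc' he
    exact T.bijOn.injOn ((T.mem_initialShape n i j).1 hc).1
      ((T.mem_initialShape n i' j').1 hc').1 he
  · rintro k ⟨hk1, hk2⟩
    obtain ⟨⟨i, j⟩, hc, he⟩ := T.bijOn.surjOn ⟨hk1, hk2.trans hn⟩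
    exact ⟨(i, j), (T.mem_initialShape n i j).2 ⟨hc, by simp only at he; omega⟩, he⟩

theorem SYT.card_initialShape {ν : YoungDiagram} (T : SYT ν) {n : ℕ} (hn : n ≤ ν.card) :
    (T.initialShape n).card = n := by
  have h := (T.initialShape_bijOn hn).image_eq
  have h2 := (T.initialShape_bijOn hn).injOn.ncard_image
  rw [h, Set.ncard_coe_finset] at h2
  rw [YoungDiagram.card, ← h2]
  simp

/-- The restriction of a standard tableau to its entries at most `n`. -/
def SYT.restrict {ν : YoungDiagram} (T : SYT ν) {n : ℕ} (hn : n ≤ ν.card) :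
    SYT (T.initialShape n) where
  entry i j := if (i, j) ∈ T.initialShape n then T.entry i j else 0
  row_strict := by
    intro i j₁ j₂ hj hm
    have h1 := (T.initialShape n).up_left_mem le_rfl hj.le hm
    simpa [h1, hm] using T.row_strict hj ((T.mem_initialShape n i j₂).1 hm).1
  col_strict := by
    intro i₁ i₂ j hi hm
    have h1 := (T.initialShape n).up_left_mem hi.le le_rfl hm
    simpa [h1, hm] using T.col_strict hi ((T.mem_initialShape n i₂ j).1 hm).1
  zeros := by
    intro i j hm
    simp [hm]
  bijOn := by
    rw [T.card_initialShape hn]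
    refine (T.initialShape_bijOn hn).congr ?_
    rintro ⟨i, j⟩ hc
    have hc : (i, j) ∈ T.initialShape n := hc
    simp [hc]

/-- Branching rule: deleting the box with the largest entry is a bijection, with inverse
`SYT.extend`. -/
theorem dim_eq_sum {n : ℕ} (ν : Shape (n + 1)) :
    dim ν.1 = ∑ μ : Shape n with μ.1 ≤ ν.1, dim μ.1 := by
  let f : (Σ μ : {μ : Shape n // μ.1 ≤ ν.1}, SYT μ.1.1) → SYT ν.1 :=
    fun x => x.2.extend x.1.1.2 ν.2 x.1.2
  have hf : Function.Bijective f := by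
    constructor
    · rintro ⟨⟨⟨μ, hμ⟩, h⟩, T⟩ ⟨⟨⟨μ', hμ'⟩, h'⟩, T'⟩ he
      have he : T.extend hμ ν.2 h = T'.extend hμ' ν.2 h' := he
      have hmm : μ = μ' := by
        refine YoungDiagram.ext (Finset.ext ?_)
        rintro ⟨i, j⟩
        have h1 := T.mem_iff_extend_entry hμ ν.2 h i j
        have h2 := T'.mem_iff_extend_entry hμ' ν.2 h' i j
        rw [he] at h1
        exact h1.trans h2.symm
      subst hmm
      have : T = T' := by
        ext i j
        by_cases hm : (i, j) ∈ μ
        · have := congrArg (fun S : SYT ν.1 => S.entry i j) he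
          simpa [SYT.extend, hm] using this
        · rw [T.zeros hm, T'.zeros hm]
      subst this
      rfl
    · intro T
      have hn : n ≤ ν.1.card := by have := ν.2; omega
      have hle : T.initialShape n ≤ ν.1 := by
        rintro ⟨i, j⟩ hc
        exact ((T.mem_initialShape n i j).1 hc).1
      refine ⟨⟨⟨⟨T.initialShape n, T.card_initialShape hn⟩, hle⟩, T.restrict hn⟩, ?_⟩
      ext i j
      change (if (i, j) ∈ T.initialShape n then (if (i, j) ∈ T.initialShape n then T.entry i j else 0)
        else if (i, j) ∈ ν.1 then n + 1 else 0) = T.entry i j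
      by_cases h1 : (i, j) ∈ T.initialShape n
      · simp [h1]
      · by_cases h2 : (i, j) ∈ ν.1
        · have h3 := (T.bijOn.mapsTo h2).2
          have h4 : ¬ T.entry i j ≤ n := fun h4 => h1 ((T.mem_initialShape n i j).2 ⟨h2, h4⟩)
          have := ν.2
          simp only at h3
          simp only [h1, h2, if_true, if_false]
          omega
        · simp [h1, h2, T.zeros h2]
  rw [dim, ← Nat.card_congr (Equiv.ofBijective f hf), Nat.card_sigma]
  simp only [dim]
  exact (Finset.sum_subtype (p := fun μ : Shape n => μ.1 ≤ ν.1)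
    (Finset.univ.filter fun μ : Shape n => μ.1 ≤ ν.1) (fun x => by simp)
    (fun μ => Nat.card (SYT μ.1))).symm

theorem rowLen_le_card (μ : YoungDiagram) (i : ℕ) : μ.rowLen i ≤ μ.card := by
  rw [YoungDiagram.rowLen_eq_card]
  exact Finset.card_le_card (Finset.filter_subset _ _)

theorem lt_card_of_rowLen_pos {μ : YoungDiagram} {i : ℕ} (h : 0 < μ.rowLen i) : i < μ.card := by
  have h1 : (i, 0) ∈ μ := YoungDiagram.mem_iff_lt_rowLen.2 h
  have h2 : i < μ.colLen 0 := YoungDiagram.mem_iff_lt_colLen.1 h1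
  rw [YoungDiagram.colLen_eq_card] at h2
  exact h2.trans_le (Finset.card_le_card (Finset.filter_subset _ _))

/-- The diagram with a box added at the end of row `i`. -/
def addBox (μ : YoungDiagram) (i : ℕ) (h : i = 0 ∨ μ.rowLen i < μ.rowLen (i - 1)) :
    YoungDiagram where
  cells := insert (i, μ.rowLen i) μ.cells
  isLowerSet := by
    rintro ⟨a, b⟩ ⟨a', b'⟩ hle hc
    obtain ⟨ha, hb⟩ : a' ≤ a ∧ b' ≤ b := hle
    simp only [Finset.coe_insert, Set.mem_insert_iff, Finset.mem_coe, YoungDiagram.mem_cells,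
      Prod.mk.injEq] at hc ⊢
    rcases hc with ⟨rfl, rfl⟩ | hc
    · rcases ha.eq_or_lt with rfl | ha
      · rcases hb.eq_or_lt with rfl | hb
        · exact Or.inl ⟨rfl, rfl⟩
        · exact Or.inr (YoungDiagram.mem_iff_lt_rowLen.2 hb)
      · right
        rcases h with h | h
        · omega
        · refine μ.up_left_mem (i2 := a - 1) (j2 := b') (by omega) le_rfl ?_
          exact YoungDiagram.mem_iff_lt_rowLen.2 (by omega)
    · exact Or.inr (μ.up_left_mem ha hb hc)

theorem card_addBox (μ : YoungDiagram) (i : ℕ) (h : i = 0 ∨ μ.rowLen i < μ.rowLen (i - 1)) :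
    (addBox μ i h).card = μ.card + 1 := by
  refine Finset.card_insert_of_notMem ?_
  rw [YoungDiagram.mem_cells, YoungDiagram.mem_iff_lt_rowLen]
  exact lt_irrefl _

/-- The diagram with the last box of row `i` removed. -/
def removeBox (μ : YoungDiagram) (i : ℕ) (h : μ.rowLen (i + 1) < μ.rowLen i) :
    YoungDiagram where
  cells := μ.cells.erase (i, μ.rowLen i - 1)
  isLowerSet := by
    rintro ⟨a, b⟩ ⟨a', b'⟩ hle hc
    obtain ⟨ha, hb⟩ : a' ≤ a ∧ b' ≤ b := hle
    simp only [Finset.coe_erase, Set.mem_sdiff, Set.mem_singleton_iff, Finset.mem_coe,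
      YoungDiagram.mem_cells, Prod.mk.injEq] at hc ⊢
    refine ⟨μ.up_left_mem ha hb hc.1, ?_⟩
    rintro ⟨rfl, rfl⟩
    have h1 : b < μ.rowLen a := YoungDiagram.mem_iff_lt_rowLen.1 hc.1
    rcases ha.eq_or_lt with rfl | ha
    · exact hc.2 ⟨rfl, by omega⟩
    · have := μ.rowLen_anti (a' + 1) a ha
      omega

theorem card_removeBox (μ : YoungDiagram) (i : ℕ) (h : μ.rowLen (i + 1) < μ.rowLen i) :
    (removeBox μ i h).card + 1 = μ.card := by
  refine Finset.card_erase_add_one ?_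
  rw [YoungDiagram.mem_cells, YoungDiagram.mem_iff_lt_rowLen]
  omega

theorem exists_eq_insert {μ ν : YoungDiagram} (h : μ ≤ ν) (hc : ν.card = μ.card + 1) :
    ∃ i j, (i, j) ∉ μ ∧ ν.cells = insert (i, j) μ.cells := by
  have hsub : μ.cells ⊆ ν.cells := YoungDiagram.cells_subset_iff.2 h
  have hd : (ν.cells \ μ.cells).card = 1 := by
    rw [Finset.card_sdiff_of_subset hsub]
    change ν.card - μ.card = 1
    omega
  obtain ⟨⟨i, j⟩, hij⟩ := Finset.card_eq_one.1 hd
  have hcm : (i, j) ∈ ν.cells \ μ.cells := by rw [hij]; simp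
  refine ⟨i, j, (Finset.mem_sdiff.1 hcm).2, ?_⟩
  rw [Finset.insert_eq, ← hij, Finset.sdiff_union_of_subset hsub]

/-- A cover adds one box, which must sit at the end of a row shorter than the one above. Such a row
is the first one or follows a nonempty row, so its index is at most `n`. -/
theorem card_covers (n : ℕ) (μ : Shape n) :
    (Finset.univ.filter fun ν : Shape (n + 1) => μ.1 ≤ ν.1).card =
      ((Finset.range (n + 1)).filter
        fun i => i = 0 ∨ μ.1.rowLen i < μ.1.rowLen (i - 1)).card := by
  symm
  refine Finset.card_bij
    (fun i hi => (⟨addBox μ.1 i (Finset.mem_filter.1 hi).2, by rw [card_addBox, μ.2]⟩ :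
      Shape (n + 1))) ?_ ?_ ?_
  · intro i hi
    simp only [Finset.mem_filter, Finset.mem_univ, true_and]
    exact YoungDiagram.cells_subset_iff.1 (Finset.subset_insert _ _)
  · intro i hi i' hi' he
    have he := congrArg (fun ν : Shape (n + 1) => ν.1.cells) he
    have h1 : (i, μ.1.rowLen i) ∈ insert (i', μ.1.rowLen i') μ.1.cells := by
      rw [← show insert (i, μ.1.rowLen i) μ.1.cells = insert (i', μ.1.rowLen i') μ.1.cells from he]
      exact Finset.mem_insert_self _ _
    rw [Finset.mem_insert, YoungDiagram.mem_cells, YoungDiagram.mem_iff_lt_rowLen] at h1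
    rcases h1 with h1 | h1
    · exact congrArg Prod.fst h1
    · exact absurd h1 (lt_irrefl _)
  · intro ν hν
    have hle : μ.1 ≤ ν.1 := (Finset.mem_filter.1 hν).2
    obtain ⟨i, j, hij, hcells⟩ := exists_eq_insert hle (by rw [ν.2, μ.2])
    have hmem : ∀ a b, (a, b) ∈ ν.1 ↔ (a = i ∧ b = j) ∨ (a, b) ∈ μ.1 := by
      intro a b
      rw [← YoungDiagram.mem_cells, hcells]
      simp
    have hνij : (i, j) ∈ ν.1 := (hmem i j).2 (Or.inl ⟨rfl, rfl⟩)
    have hj : μ.1.rowLen i = j := by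
      apply le_antisymm
      · rw [YoungDiagram.mem_iff_lt_rowLen] at hij
        omega
      · by_contra hlt
        have h1 := ν.1.up_left_mem le_rfl (not_le.1 hlt).le hνij
        rcases (hmem _ _).1 h1 with h2 | h2
        · omega
        · exact absurd (YoungDiagram.mem_iff_lt_rowLen.1 h2) (lt_irrefl _)
    have hi : i = 0 ∨ μ.1.rowLen i < μ.1.rowLen (i - 1) := by
      rcases Nat.eq_zero_or_pos i with h0 | h0
      · exact Or.inl h0
      · right
        have h1 := ν.1.up_left_mem (i1 := i - 1) (by omega) le_rfl hνij
        rcases (hmem _ _).1 h1 with h2 | h2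
        · omega
        · rw [hj]
          exact YoungDiagram.mem_iff_lt_rowLen.1 h2
    have hin : i < n + 1 := by
      rcases hi with h0 | h0
      · omega
      · have := lt_card_of_rowLen_pos (μ := μ.1) (i := i - 1) (by omega)
        have := μ.2
        omega
    refine ⟨i, Finset.mem_filter.2 ⟨Finset.mem_range.2 hin, hi⟩, ?_⟩
    refine Subtype.ext (YoungDiagram.ext ?_)
    rw [hcells]
    simp [addBox, hj]

theorem card_coveredBy (n : ℕ) (μ : Shape (n + 1)) :
    (Finset.univ.filter fun κ : Shape n => κ.1 ≤ μ.1).card =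
      ((Finset.range (n + 1)).filter fun i => μ.1.rowLen (i + 1) < μ.1.rowLen i).card := by
  symm
  refine Finset.card_bij
    (fun i hi => (⟨removeBox μ.1 i (Finset.mem_filter.1 hi).2, by
      have := card_removeBox μ.1 i (Finset.mem_filter.1 hi).2
      have := μ.2
      omega⟩ : Shape n)) ?_ ?_ ?_
  · intro i hi
    simp only [Finset.mem_filter, Finset.mem_univ, true_and]
    exact YoungDiagram.cells_subset_iff.1 (Finset.erase_subset _ _)
  · intro i hi i' hi' he
    have he : μ.1.cells.erase (i, μ.1.rowLen i - 1) = μ.1.cells.erase (i', μ.1.rowLen i' - 1) :=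
      congrArg (fun ν : Shape n => ν.1.cells) he
    by_contra hne
    have h1 : (i, μ.1.rowLen i - 1) ∈ μ.1.cells.erase (i', μ.1.rowLen i' - 1) := by
      rw [Finset.mem_erase, YoungDiagram.mem_cells, YoungDiagram.mem_iff_lt_rowLen]
      have := (Finset.mem_filter.1 hi).2
      exact ⟨fun h => hne (congrArg Prod.fst h), by omega⟩
    rw [← he] at h1
    simp at h1
  · intro κ hκ
    have hle : κ.1 ≤ μ.1 := (Finset.mem_filter.1 hκ).2
    obtain ⟨i, j, hij, hcells⟩ := exists_eq_insert hle (by rw [κ.2, μ.2])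
    have hmem : ∀ a b, (a, b) ∈ μ.1 ↔ (a = i ∧ b = j) ∨ (a, b) ∈ κ.1 := by
      intro a b
      rw [← YoungDiagram.mem_cells, hcells]
      simp
    have h1 : j < μ.1.rowLen i :=
      YoungDiagram.mem_iff_lt_rowLen.1 ((hmem i j).2 (Or.inl ⟨rfl, rfl⟩))
    have h2 : ¬ j + 1 < μ.1.rowLen i := by
      rw [← YoungDiagram.mem_iff_lt_rowLen, hmem]
      rintro (h | h)
      · omega
      · exact hij (κ.1.up_left_mem le_rfl (by omega) h)
    have h3 : ¬ j < μ.1.rowLen (i + 1) := by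
      rw [← YoungDiagram.mem_iff_lt_rowLen, hmem]
      rintro (h | h)
      · omega
      · exact hij (κ.1.up_left_mem (by omega) le_rfl h)
    have hi : i < n + 1 := by
      have := lt_card_of_rowLen_pos (μ := μ.1) (i := i) (by omega)
      have := μ.2
      omega
    refine ⟨i, Finset.mem_filter.2 ⟨Finset.mem_range.2 hi, by omega⟩, ?_⟩
    refine Subtype.ext (YoungDiagram.ext ?_)
    have hj : μ.1.rowLen i - 1 = j := by omega
    simp only [removeBox, hj]
    rw [hcells, Finset.erase_insert hij]

/-- A box can be added to row `i + 1` exactly when one can be removed from row `i`; row `0` always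
accepts one more, whence the `+ 1`. -/
theorem card_covers_eq_card_coveredBy_add_one (n : ℕ) (μ : Shape (n + 1)) :
    (Finset.univ.filter fun ν : Shape (n + 2) => μ.1 ≤ ν.1).card =
      (Finset.univ.filter fun κ : Shape n => κ.1 ≤ μ.1).card + 1 := by
  rw [card_covers, card_coveredBy]
  have h : (Finset.range (n + 1 + 1)).filter (fun i => i = 0 ∨ μ.1.rowLen i < μ.1.rowLen (i - 1)) =
      insert 0 (((Finset.range (n + 1)).filter
        fun i => μ.1.rowLen (i + 1) < μ.1.rowLen i).image Nat.succ) := by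
    ext i
    simp only [Finset.mem_filter, Finset.mem_range, Finset.mem_insert, Finset.mem_image]
    cases i with
    | zero => simp
    | succ i =>
      constructor
      · rintro ⟨h1, h2⟩
        exact Or.inr ⟨i, ⟨by omega, by simpa using h2⟩, rfl⟩
      · rintro (h | ⟨j, ⟨h1, h2⟩, h3⟩)
        · omega
        · obtain rfl : j = i := by simpa using h3
          exact ⟨by omega, Or.inr (by simpa using h2)⟩
  rw [h, Finset.card_insert_of_notMem (by simp),
    Finset.card_image_of_injective _ Nat.succ_injective]

/-- The only candidates are the join and the meet. Their sizes add up to `2 n + 2`, so they have the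
right sizes simultaneously or not at all. -/
theorem card_common_covers {n : ℕ} {μ ν : Shape (n + 1)} (hne : μ ≠ ν) :
    (Finset.univ.filter fun l : Shape (n + 2) => μ.1 ≤ l.1 ∧ ν.1 ≤ l.1).card =
      (Finset.univ.filter fun κ : Shape n => κ.1 ≤ μ.1 ∧ κ.1 ≤ ν.1).card := by
  have hcard := card_sup_add_card_inf μ.1 ν.1
  have hμ := μ.2
  have hν := ν.2
  have hsup : n + 2 ≤ (μ.1 ⊔ ν.1).card := by
    by_contra h
    have h1 : μ.1 = μ.1 ⊔ ν.1 := eq_of_le_of_card_le le_sup_left (by omega)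
    have h2 : ν.1 = μ.1 ⊔ ν.1 := eq_of_le_of_card_le le_sup_right (by omega)
    exact hne (Subtype.ext (h1.trans h2.symm))
  by_cases h : (μ.1 ⊔ ν.1).card = n + 2
  · have h' : (μ.1 ⊓ ν.1).card = n := by omega
    rw [Finset.card_eq_one.2 ⟨⟨μ.1 ⊔ ν.1, h⟩, ?_⟩, Finset.card_eq_one.2 ⟨⟨μ.1 ⊓ ν.1, h'⟩, ?_⟩]
    · ext κ
      simp only [Finset.mem_filter, Finset.mem_univ, true_and, Finset.mem_singleton]
      constructor
      · intro hκ
        exact Subtype.ext (eq_of_le_of_card_le (le_inf hκ.1 hκ.2) (by rw [κ.2, h']))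
      · rintro rfl
        exact ⟨inf_le_left, inf_le_right⟩
    · ext l
      simp only [Finset.mem_filter, Finset.mem_univ, true_and, Finset.mem_singleton]
      constructor
      · intro hl
        exact Subtype.ext (eq_of_le_of_card_le (sup_le hl.1 hl.2) (by rw [l.2, h])).symm
      · rintro rfl
        exact ⟨le_sup_left, le_sup_right⟩
  · rw [Finset.filter_false_of_mem (p := fun l : Shape (n + 2) => μ.1 ≤ l.1 ∧ ν.1 ≤ l.1),
      Finset.filter_false_of_mem (p := fun κ : Shape n => κ.1 ≤ μ.1 ∧ κ.1 ≤ ν.1)]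
    · rfl
    · intro κ _ hκ
      have := card_le_card_of_le (le_inf hκ.1 hκ.2)
      rw [κ.2] at this
      omega
    · intro l _ hl
      have := card_le_card_of_le (sup_le hl.1 hl.2)
      rw [l.2] at this
      omega

/-- This is the relation `DU = UD + 1` of a differential poset applied to the vector of dimensions,
by recursion on `n`. Going up and then down equals going down and then up, plus one extra copy of
`μ`. -/
theorem sum_dim_covers (n : ℕ) (μ : Shape n) :
    ∑ ν : Shape (n + 1) with μ.1 ≤ ν.1, dim ν.1 = (n + 1) * dim μ.1 := by
  have key : ∑ ν : Shape (n + 1) with μ.1 ≤ ν.1, dim ν.1 =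
      ∑ ρ : Shape n, dim ρ.1 *
        (Finset.univ.filter fun ν : Shape (n + 1) => μ.1 ≤ ν.1 ∧ ρ.1 ≤ ν.1).card := by
    simp_rw [dim_eq_sum, Finset.card_filter, Finset.mul_sum, Finset.sum_filter]
    rw [Finset.sum_comm]
    refine Finset.sum_congr rfl fun ν _ => ?_
    by_cases h : μ.1 ≤ ν.1
    · simp [h]
    · simp [h]
  cases n with
  | zero =>
    have hbot : ∀ ρ : Shape 0, ρ.1 = ⊥ := fun ρ =>
      (eq_of_le_of_card_le bot_le (by rw [ρ.2]; exact Nat.zero_le _)).symm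
    have huniq : (Finset.univ : Finset (Shape 0)) = {μ} := by
      ext ρ
      simp [Subtype.ext_iff, hbot]
    rw [key, huniq, Finset.sum_singleton]
    simp only [and_self]
    rw [card_covers]
    simp [Finset.filter_singleton]
  | succ n =>
    have hρ : ∀ ρ : Shape (n + 1), dim ρ.1 *
        (Finset.univ.filter fun ν : Shape (n + 2) => μ.1 ≤ ν.1 ∧ ρ.1 ≤ ν.1).card =
        dim ρ.1 * (Finset.univ.filter fun κ : Shape n => κ.1 ≤ μ.1 ∧ κ.1 ≤ ρ.1).card +
          if ρ = μ then dim μ.1 else 0 := by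
      intro ρ
      by_cases h : ρ = μ
      · subst h
        simp only [and_self, if_true]
        rw [card_covers_eq_card_coveredBy_add_one, mul_add, mul_one]
      · rw [card_common_covers (Ne.symm h), if_neg h, add_zero]
    rw [key, Finset.sum_congr rfl fun ρ _ => hρ ρ, Finset.sum_add_distrib, Finset.sum_ite_eq']
    simp only [Finset.mem_univ, if_true]
    -- Regrouping by the common lower neighbour `κ` exposes the same sum one level down.
    have h2 : ∑ ρ : Shape (n + 1), dim ρ.1 *
        (Finset.univ.filter fun κ : Shape n => κ.1 ≤ μ.1 ∧ κ.1 ≤ ρ.1).card =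
        ∑ κ : Shape n with κ.1 ≤ μ.1, ∑ ρ : Shape (n + 1) with κ.1 ≤ ρ.1, dim ρ.1 := by
      simp_rw [Finset.card_filter, Finset.mul_sum, Finset.sum_filter]
      rw [Finset.sum_comm]
      refine Finset.sum_congr rfl fun κ _ => ?_
      by_cases h : κ.1 ≤ μ.1
      · simp [h]
      · simp [h]
    rw [h2, Finset.sum_congr rfl fun κ _ => sum_dim_covers n κ, ← Finset.mul_sum, ← dim_eq_sum]
    ring

/-- Expanding one factor of each square by the branching rule and exchanging the sums gives the
factor `n + 1` at each level. -/
theorem sum_dim_sq (n : ℕ) : ∑ μ : Shape n, dim μ.1 ^ 2 = n.factorial := by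
  induction n with
  | zero =>
    have hbot : ∀ ρ : Shape 0, ρ.1 = ⊥ := fun ρ =>
      (eq_of_le_of_card_le bot_le (by rw [ρ.2]; exact Nat.zero_le _)).symm
    have huniq : (Finset.univ : Finset (Shape 0)) = {⟨⊥, rfl⟩} := by
      ext ρ
      simp [Subtype.ext_iff, hbot]
    rw [huniq, Finset.sum_singleton]
    have h1 : dim ⊥ = 1 := by
      rw [dim, Nat.card_eq_one_iff_unique]
      refine ⟨⟨fun T S => ?_⟩, ⟨⟨fun _ _ => 0, ?_, ?_, ?_, ?_⟩⟩⟩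
      · ext i j
        rw [T.zeros (YoungDiagram.notMem_bot _), S.zeros (YoungDiagram.notMem_bot _)]
      · intro i j₁ j₂ _ h
        exact absurd h (YoungDiagram.notMem_bot _)
      · intro i j₁ j₂ _ h
        exact absurd h (YoungDiagram.notMem_bot _)
      · intros
        rfl
      · simp [YoungDiagram.card]
    simp [h1]
  | succ n ih =>
    have h : ∀ ν : Shape (n + 1), dim ν.1 ^ 2 =
        ∑ μ : Shape n, if μ.1 ≤ ν.1 then dim μ.1 * dim ν.1 else 0 := by
      intro ν
      rw [sq]
      nth_rewrite 1 [dim_eq_sum]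
      rw [Finset.sum_mul, Finset.sum_filter]
    simp_rw [h]
    rw [Finset.sum_comm]
    have h2 : ∀ μ : Shape n, (∑ ν : Shape (n + 1), if μ.1 ≤ ν.1 then dim μ.1 * dim ν.1 else 0) =
        (n + 1) * dim μ.1 ^ 2 := by
      intro μ
      rw [← Finset.sum_filter, ← Finset.mul_sum, sum_dim_covers]
      ring
    simp_rw [h2]
    rw [← Finset.mul_sum, ih, Nat.factorial_succ]

end YoungLattice

/-! ### Boxes, contents and exchanges of entries in standard tableaux -/

namespace SYT

variable {μ ν : YoungDiagram}

/-- The box of `T` with entry `k + 1`. -/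
def box (T : SYT μ) (k : ℕ) : ℕ × ℕ :=
  Function.invFunOn (fun c : ℕ × ℕ => T.entry c.1 c.2) μ.cells (k + 1)

theorem box_mem (T : SYT μ) {k : ℕ} (hk : k < μ.card) : T.box k ∈ μ :=
  Function.invFunOn_mem (T.bijOn.surjOn ⟨by omega, by omega⟩)

theorem entry_box (T : SYT μ) {k : ℕ} (hk : k < μ.card) :
    T.entry (T.box k).1 (T.box k).2 = k + 1 :=
  Function.invFunOn_eq (f := fun c : ℕ × ℕ => T.entry c.1 c.2)
    (T.bijOn.surjOn ⟨by omega, by omega⟩)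

theorem one_le_entry (T : SYT μ) {c : ℕ × ℕ} (hc : c ∈ μ) : 1 ≤ T.entry c.1 c.2 :=
  (T.bijOn.mapsTo hc).1

theorem entry_le_card (T : SYT μ) {c : ℕ × ℕ} (hc : c ∈ μ) : T.entry c.1 c.2 ≤ μ.card :=
  (T.bijOn.mapsTo hc).2

theorem entry_injOn (T : SYT μ) {c d : ℕ × ℕ} (hc : c ∈ μ) (hd : d ∈ μ)
    (h : T.entry c.1 c.2 = T.entry d.1 d.2) : c = d :=
  T.bijOn.injOn hc hd h

theorem box_eq_iff (T : SYT μ) {k : ℕ} (hk : k < μ.card) {c : ℕ × ℕ} :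
    T.box k = c ↔ c ∈ μ ∧ T.entry c.1 c.2 = k + 1 := by
  constructor
  · rintro rfl
    exact ⟨T.box_mem hk, T.entry_box hk⟩
  · rintro ⟨h1, h2⟩
    exact T.entry_injOn (T.box_mem hk) h1 (by rw [T.entry_box hk, h2])

theorem exists_box_eq (T : SYT μ) {c : ℕ × ℕ} (hc : c ∈ μ) :
    ∃ k < μ.card, T.box k = c ∧ T.entry c.1 c.2 = k + 1 := by
  have h1 := T.one_le_entry hc
  have h2 := T.entry_le_card hc
  exact ⟨T.entry c.1 c.2 - 1, by omega, (T.box_eq_iff (by omega)).2 ⟨hc, by omega⟩, by omega⟩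

theorem box_inj (T : SYT μ) {k l : ℕ} (hk : k < μ.card) (hl : l < μ.card)
    (h : T.box k = T.box l) : k = l := by
  have h1 := T.entry_box hk
  rw [h, T.entry_box hl] at h1
  omega

theorem entry_mono (T : SYT μ) {i j i' j' : ℕ} (hi : i' ≤ i) (hj : j' ≤ j) (h : (i, j) ∈ μ) :
    T.entry i' j' ≤ T.entry i j := by
  have h1 : T.entry i' j' ≤ T.entry i j' := by
    rcases hi.eq_or_lt with rfl | hi
    · exact le_rfl
    · exact (T.col_strict hi (μ.up_left_mem le_rfl hj h)).le
  have h2 : T.entry i j' ≤ T.entry i j := by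
    rcases hj.eq_or_lt with rfl | hj
    · exact le_rfl
    · exact (T.row_strict hj h).le
  exact h1.trans h2

/-- A box weakly to the upper left of another one comes first. -/
theorem le_of_box_le (T : SYT μ) {k l : ℕ} (hk : k < μ.card) (hl : l < μ.card)
    (h1 : (T.box k).1 ≤ (T.box l).1) (h2 : (T.box k).2 ≤ (T.box l).2) : k ≤ l := by
  have := T.entry_mono h1 h2 (T.box_mem hl)
  rw [T.entry_box hk, T.entry_box hl] at this
  omega

theorem ext_box {T S : SYT μ} (h : ∀ k < μ.card, T.box k = S.box k) : T = S := by
  ext i j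
  by_cases hc : (i, j) ∈ μ
  · obtain ⟨k, hk, h1, h2⟩ := T.exists_box_eq hc
    rw [h k hk] at h1
    have h3 := S.entry_box hk
    rw [h1] at h3
    simp only at h2 h3
    rw [h2, h3]
  · rw [T.zeros hc, S.zeros hc]

/-- The content of the box of `T` with entry `k + 1`. -/
def content (T : SYT μ) (k : ℕ) : ℤ := (T.box k).2 - (T.box k).1

/-- Equal contents put the two boxes on one diagonal. If they differed, the upper left one would
also be filled in the other tableau, with a smaller entry; by induction that entry occupies the same
box in both tableaux, so one box would carry two entries. -/
theorem box_eq_of_content_eq (T : SYT μ) (S : SYT ν) (hc : μ.card = ν.card)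
    (h : ∀ k < μ.card, T.content k = S.content k) :
    ∀ k < μ.card, T.box k = S.box k := by
  intro k
  induction k using Nat.strong_induction_on with
  | _ k ih =>
    intro hk
    have hk' : k < ν.card := hc ▸ hk
    have hcont := h k hk
    simp only [content] at hcont
    rcases lt_trichotomy (T.box k).1 (S.box k).1 with hlt | heq | hlt
    · exfalso
      have hle : (T.box k).2 ≤ (S.box k).2 := by omega
      have hmem : T.box k ∈ ν := ν.up_left_mem (i2 := (S.box k).1) (j2 := (S.box k).2)
        hlt.le hle (S.box_mem hk')
      obtain ⟨m, hm, h1, h2⟩ := S.exists_box_eq hmem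
      have hmk : m ≤ k := S.le_of_box_le hm hk' (by rw [h1]; omega) (by rw [h1]; omega)
      have hne : m ≠ k := by
        rintro rfl
        rw [h1] at hlt
        omega
      have h3 := ih m (by omega) (by omega)
      exact hne (T.box_inj (by omega) hk (h3.trans h1))
    · exact Prod.ext heq (by omega)
    · exfalso
      have hle : (S.box k).2 ≤ (T.box k).2 := by omega
      have hmem : S.box k ∈ μ := μ.up_left_mem (i2 := (T.box k).1) (j2 := (T.box k).2)
        hlt.le hle (T.box_mem hk)
      obtain ⟨m, hm, h1, h2⟩ := T.exists_box_eq hmem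
      have hmk : m ≤ k := T.le_of_box_le hm hk (by rw [h1]; omega) (by rw [h1]; omega)
      have hne : m ≠ k := by
        rintro rfl
        rw [h1] at hlt
        omega
      have h3 := ih m (by omega) (by omega)
      exact hne (S.box_inj (by omega) hk' (h3.symm.trans h1))

theorem shape_eq_of_content_eq (T : SYT μ) (S : SYT ν) (hc : μ.card = ν.card)
    (h : ∀ k < μ.card, T.content k = S.content k) : μ = ν := by
  have hb := T.box_eq_of_content_eq S hc h
  refine YoungDiagram.ext (Finset.ext fun c => ⟨fun hm => ?_, fun hm => ?_⟩)
  · obtain ⟨k, hk, h1, -⟩ := T.exists_box_eq hm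
    rw [← h1, hb k hk]
    exact S.box_mem (hc ▸ hk)
  · obtain ⟨k, hk, h1, -⟩ := S.exists_box_eq hm
    rw [← h1, ← hb k (hc ▸ hk)]
    exact T.box_mem (hc ▸ hk)

theorem eq_of_content_eq {T S : SYT μ} (h : ∀ k < μ.card, T.content k = S.content k) : T = S :=
  ext_box (T.box_eq_of_content_eq S rfl h)

theorem sum_cells (T : SYT μ) {M : Type*} [AddCommMonoid M] (f : ℕ × ℕ → M) :
    ∑ c ∈ μ.cells, f c = ∑ k ∈ Finset.range μ.card, f (T.box k) := by
  symm
  refine Finset.sum_bij (fun k _ => T.box k) ?_ ?_ ?_ ?_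
  · exact fun k hk => T.box_mem (Finset.mem_range.1 hk)
  · exact fun k hk l hl h => T.box_inj (Finset.mem_range.1 hk) (Finset.mem_range.1 hl) h
  · intro c hc
    obtain ⟨k, hk, h, -⟩ := T.exists_box_eq hc
    exact ⟨k, Finset.mem_range.2 hk, h⟩
  · exact fun _ _ => rfl

theorem eig_eq_sum_content (T : SYT μ) :
    eig T = (1 / (μ.card : ℝ)) *
      ∑ k ∈ Finset.range μ.card, ((T.content k : ℝ) + 1) / ((k : ℝ) + 1) := by
  rw [eig, T.sum_cells]
  congr 1
  refine Finset.sum_congr rfl fun k hk => ?_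
  rw [T.entry_box (Finset.mem_range.1 hk)]
  simp [content]

/-- The tableau with the entries `k + 1` and `k + 2` exchanged, when they are neither in the same
row nor in the same column. -/
def swap (T : SYT μ) (k : ℕ) (hk : k + 1 < μ.card) (h1 : (T.box k).1 ≠ (T.box (k + 1)).1)
    (h2 : (T.box k).2 ≠ (T.box (k + 1)).2) : SYT μ where
  entry i j := Equiv.swap (k + 1) (k + 2) (T.entry i j)
  row_strict := by
    intro i j₁ j₂ hj hm
    have hlt := T.row_strict hj hm
    have hm' := μ.up_left_mem le_rfl hj.le hm
    have hne : ¬ (T.entry i j₁ = k + 1 ∧ T.entry i j₂ = k + 2) := by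
      rintro ⟨e1, e2⟩
      rw [(T.box_eq_iff (c := (i, j₁)) (by omega)).2 ⟨hm', e1⟩,
        (T.box_eq_iff (c := (i, j₂)) (by omega)).2 ⟨hm, e2⟩] at h1
      exact h1 rfl
    simp only [Equiv.swap_apply_def]
    split_ifs <;> omega
  col_strict := by
    intro i₁ i₂ j hi hm
    have hlt := T.col_strict hi hm
    have hm' := μ.up_left_mem hi.le le_rfl hm
    have hne : ¬ (T.entry i₁ j = k + 1 ∧ T.entry i₂ j = k + 2) := by
      rintro ⟨e1, e2⟩
      rw [(T.box_eq_iff (c := (i₁, j)) (by omega)).2 ⟨hm', e1⟩,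
        (T.box_eq_iff (c := (i₂, j)) (by omega)).2 ⟨hm, e2⟩] at h2
      exact h2 rfl
    simp only [Equiv.swap_apply_def]
    split_ifs <;> omega
  zeros := by
    intro i j hm
    rw [T.zeros hm, Equiv.swap_apply_of_ne_of_ne] <;> omega
  bijOn := by
    have h : Set.BijOn (Equiv.swap (k + 1) (k + 2)) (Set.Icc 1 μ.card) (Set.Icc 1 μ.card) := by
      have hmaps : Set.MapsTo (Equiv.swap (k + 1) (k + 2)) (Set.Icc 1 μ.card)
          (Set.Icc 1 μ.card) := by
        rintro m ⟨hm1, hm2⟩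
        simp only [Equiv.swap_apply_def, Set.mem_Icc]
        split_ifs <;> omega
      refine ⟨hmaps, (Equiv.injective _).injOn, fun m hm => ?_⟩
      exact ⟨Equiv.swap (k + 1) (k + 2) m, hmaps hm, Equiv.swap_apply_self _ _ _⟩
    exact h.comp T.bijOn

theorem box_swap (T : SYT μ) (k : ℕ) (hk : k + 1 < μ.card) (h1 : (T.box k).1 ≠ (T.box (k + 1)).1)
    (h2 : (T.box k).2 ≠ (T.box (k + 1)).2) {l : ℕ} (hl : l < μ.card) :
    (T.swap k hk h1 h2).box l = T.box (Equiv.swap k (k + 1) l) := by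
  have hl' : Equiv.swap k (k + 1) l < μ.card := by
    simp only [Equiv.swap_apply_def]
    split_ifs <;> omega
  rw [box_eq_iff _ hl]
  refine ⟨T.box_mem hl', ?_⟩
  change Equiv.swap (k + 1) (k + 2) (T.entry _ _) = l + 1
  rw [T.entry_box hl']
  simp only [Equiv.swap_apply_def]
  split_ifs <;> omega

/-- The boxes in the order of their entries run through the columns from left to right, and
through each column from top to bottom. -/
def ColumnOrdered (T : SYT μ) : Prop :=
  ∀ k l, k < l → l < μ.card →
    toLex ((T.box k).2, (T.box k).1) < toLex ((T.box l).2, (T.box l).1)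

/-- A strictly increasing enumeration of a given set of boxes is unique. This lets separate descents
from `T` and from `S` end at the same tableau. -/
theorem ColumnOrdered.unique {T S : SYT μ} (hT : T.ColumnOrdered) (hS : S.ColumnOrdered) :
    T = S := by
  let f (R : SYT μ) (k : Fin μ.card) : ℕ ×ₗ ℕ := toLex ((R.box k).2, (R.box k).1)
  have hf : ∀ R : SYT μ, R.ColumnOrdered → StrictMono (f R) :=
    fun R hR k l hkl => hR k l hkl l.2
  have hrange : ∀ R : SYT μ, Set.range (f R) = (fun c => toLex (c.2, c.1)) '' {c | c ∈ μ} := by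
    intro R
    ext x
    constructor
    · rintro ⟨k, rfl⟩
      exact ⟨R.box k, R.box_mem k.2, rfl⟩
    · rintro ⟨c, hc, rfl⟩
      obtain ⟨k, hk, h, -⟩ := R.exists_box_eq hc
      exact ⟨⟨k, hk⟩, by simp only [f, h]⟩
  have h : f T = f S := by
    have := StrictMono.range_inj (hf T hT) (hf S hS)
    exact this.1 ((hrange T).trans (hrange S).symm)
  refine ext_box fun k hk => ?_
  have := congrArg ofLex (congrFun h ⟨k, hk⟩)
  simp only [f, ofLex_toLex, Prod.mk.injEq] at this
  exact Prod.ext this.2 this.1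

theorem exists_descent {T : SYT μ} (hT : ¬ T.ColumnOrdered) :
    ∃ k, k + 1 < μ.card ∧ (T.box (k + 1)).2 < (T.box k).2 ∧ (T.box k).1 < (T.box (k + 1)).1 := by
  by_contra! hcon
  apply hT
  -- The next box is never weakly to the upper left, and not to the lower left when there is no
  -- descent, so it is later in column order.
  have hstep : ∀ k, k + 1 < μ.card →
      toLex ((T.box k).2, (T.box k).1) < toLex ((T.box (k + 1)).2, (T.box (k + 1)).1) := by
    intro k hk
    rw [Prod.Lex.toLex_lt_toLex]
    have h1 := hcon k hk
    have h2 := T.le_of_box_le (k := k + 1) (l := k) hk (by omega)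
    simp only
    omega
  intro k l hkl
  induction l, hkl using Nat.le_induction with
  | base => exact hstep k
  | succ l hl ih => exact fun h => (ih (by omega)).trans (hstep l h)

/-- The sum of the numbers `column * (entry - 1)`; it grows when a descent is removed. -/
def columnStatistic (T : SYT μ) : ℕ := ∑ k ∈ Finset.range μ.card, (T.box k).2 * k

theorem columnStatistic_le (T : SYT μ) : T.columnStatistic ≤ μ.card * (μ.card * μ.card) := by
  rw [columnStatistic]
  refine (Finset.sum_le_card_nsmul _ _ (μ.card * μ.card) ?_).trans ?_
  · intro k hk
    have hk := Finset.mem_range.1 hk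
    have h1 : (T.box k).2 < μ.rowLen (T.box k).1 :=
      YoungDiagram.mem_iff_lt_rowLen.1 (T.box_mem hk)
    have h2 := rowLen_le_card μ (T.box k).1
    exact Nat.mul_le_mul (by omega) hk.le
  · simp

theorem columnStatistic_lt_swap (T : SYT μ) (k : ℕ) (hk : k + 1 < μ.card)
    (h1 : (T.box k).1 ≠ (T.box (k + 1)).1) (h2 : (T.box (k + 1)).2 < (T.box k).2) :
    T.columnStatistic < (T.swap k hk h1 h2.ne').columnStatistic := by
  rw [columnStatistic, columnStatistic]
  have hsub : ({k, k + 1} : Finset ℕ) ⊆ Finset.range μ.card := by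
    intro m hm
    simp only [Finset.mem_insert, Finset.mem_singleton] at hm
    rw [Finset.mem_range]
    omega
  rw [← Finset.sum_sdiff hsub, ← Finset.sum_sdiff hsub (f := fun l => (box (T.swap k hk h1 h2.ne') l).2 * l)]
  have hrest : ∑ l ∈ Finset.range μ.card \ {k, k + 1}, (box (T.swap k hk h1 h2.ne') l).2 * l =
      ∑ l ∈ Finset.range μ.card \ {k, k + 1}, (T.box l).2 * l := by
    refine Finset.sum_congr rfl fun l hl => ?_
    simp only [Finset.mem_sdiff, Finset.mem_range, Finset.mem_insert, Finset.mem_singleton,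
      not_or] at hl
    rw [box_swap _ _ _ _ _ hl.1, Equiv.swap_apply_of_ne_of_ne hl.2.1 hl.2.2]
  rw [hrest, Finset.sum_pair (by omega), Finset.sum_pair (by omega),
    box_swap _ _ _ _ _ (by omega), box_swap _ _ _ _ _ hk, Equiv.swap_apply_left,
    Equiv.swap_apply_right]
  nlinarith

/-- To prove a property of all standard tableaux of a shape, prove it for the column-ordered one
and show that it is preserved by exchanging the entries at a descent. -/
theorem induction_descent {p : SYT μ → Prop} (h0 : ∀ T, T.ColumnOrdered → p T)
    (hs : ∀ (T : SYT μ) (k : ℕ) (hk : k + 1 < μ.card) (h1 : (T.box k).1 < (T.box (k + 1)).1)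
      (h2 : (T.box (k + 1)).2 < (T.box k).2), p (T.swap k hk h1.ne h2.ne') → p T) (T : SYT μ) :
    p T := by
  induction hm : μ.card * (μ.card * μ.card) - T.columnStatistic using
    Nat.strong_induction_on generalizing T with
  | _ m ih =>
    by_cases hT : T.ColumnOrdered
    · exact h0 T hT
    · obtain ⟨k, hk, h2, h1⟩ := exists_descent hT
      refine hs T k hk h1 h2 (ih _ ?_ _ rfl)
      have h3 := T.columnStatistic_lt_swap k hk h1.ne h2
      have h4 := (T.swap k hk h1.ne h2.ne').columnStatistic_le
      omega

end SYT

/-! ### Vandermonde products over columns, and Lagrange interpolation -/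

section Vandermonde

variable {ι : Type*} [LinearOrder ι]

/-- The Vandermonde product of the numbers `y p`, `p ∈ s`. -/
def vandermonde (s : Finset ι) (y : ι → ℂ) : ℂ :=
  ∏ p ∈ s, ∏ q ∈ s, if p < q then y q - y p else 1

theorem vandermonde_congr {s : Finset ι} {y z : ι → ℂ} (h : ∀ p ∈ s, y p = z p) :
    vandermonde s y = vandermonde s z :=
  Finset.prod_congr rfl fun p hp => Finset.prod_congr rfl fun q hq => by rw [h p hp, h q hq]

theorem vandermonde_ne_zero {s : Finset ι} {y : ι → ℂ} (hy : Function.Injective y) :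
    vandermonde s y ≠ 0 := by
  refine Finset.prod_ne_zero_iff.2 fun p _ => Finset.prod_ne_zero_iff.2 fun q _ => ?_
  split_ifs with h
  · exact sub_ne_zero.2 fun he => h.ne (hy he).symm
  · exact one_ne_zero

/-- The sign comes from reordering the factors and does not depend on `y`; it cancels whenever two
values of `y` are compared. -/
theorem exists_vandermonde_insert {s : Finset ι} {i : ι} (hi : i ∉ s) :
    ∃ ε : ℂ, ∀ y : ι → ℂ,
      vandermonde (insert i s) y = ε * (∏ l ∈ s, (y i - y l)) * vandermonde s y := by
  refine ⟨∏ l ∈ s, if i < l then -1 else 1, fun y => ?_⟩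
  simp only [vandermonde, Finset.prod_insert hi, lt_irrefl, if_false, one_mul,
    Finset.prod_mul_distrib]
  rw [← mul_assoc, ← Finset.prod_mul_distrib (f := fun l => if i < l then (-1 : ℂ) else 1),
    ← Finset.prod_mul_distrib]
  congr 1
  refine Finset.prod_congr rfl fun l hl => ?_
  rcases lt_trichotomy i l with h | h | h
  · simp [h, h.not_gt]
  · exact absurd (h ▸ hl) hi
  · simp [h, h.not_gt]

theorem vandermonde_comp_swap {s : Finset ι} {i k : ι} (hi : i ∈ s) (hk : k ∈ s) (hik : i ≠ k)
    (y : ι → ℂ) : vandermonde s (y ∘ Equiv.swap i k) = - vandermonde s y := by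
  obtain ⟨t, hkt, hit, rfl⟩ : ∃ t : Finset ι, k ∉ t ∧ i ∉ insert k t ∧ s = insert i (insert k t) := by
    refine ⟨(s.erase i).erase k, Finset.notMem_erase _ _, ?_, ?_⟩
    · rw [Finset.insert_erase (Finset.mem_erase.2 ⟨hik.symm, hk⟩)]
      exact Finset.notMem_erase _ _
    · rw [Finset.insert_erase (Finset.mem_erase.2 ⟨hik.symm, hk⟩), Finset.insert_erase hi]
  obtain ⟨ε, h1⟩ := exists_vandermonde_insert hit
  obtain ⟨δ, h2⟩ := exists_vandermonde_insert hkt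
  have hit' : i ∉ t := fun h => hit (Finset.mem_insert_of_mem h)
  have hz : ∀ l ∈ t, (y ∘ Equiv.swap i k) l = y l := by
    intro l hl
    rw [Function.comp_apply, Equiv.swap_apply_of_ne_of_ne]
    · exact fun h => hit' (h ▸ hl)
    · exact fun h => hkt (h ▸ hl)
  have hprod : ∀ a : ℂ, ∏ l ∈ t, (a - (y ∘ Equiv.swap i k) l) = ∏ l ∈ t, (a - y l) := fun a =>
    Finset.prod_congr rfl fun l hl => by rw [hz l hl]
  rw [h1, h1, h2, h2, vandermonde_congr hz, Finset.prod_insert hkt, Finset.prod_insert hkt,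
    hprod, hprod]
  simp only [Function.comp_apply, Equiv.swap_apply_left, Equiv.swap_apply_right]
  ring

/-- After the exchange, the product over `s` acquires the Lagrange basis polynomial of `i` evaluated
at `y k`, and the other product contains the nodal polynomial of `t` evaluated at `y i`. That
polynomial has degree `t.card < s.card`, so interpolation at the nodes in `s` reproduces it exactly.
-/
theorem sum_vandermonde_mul_vandermonde {s t : Finset ι} {k : ι} (hks : k ∉ s) (hkt : k ∉ t)
    (hst : Disjoint s t) (hcard : t.card < s.card) {y : ι → ℂ} (hy : Function.Injective y) :
    ∑ i ∈ s, vandermonde s (y ∘ Equiv.swap i k) *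
        vandermonde (insert k t) (y ∘ Equiv.swap i k) =
      vandermonde s y * vandermonde (insert k t) y := by
  obtain ⟨δ, h2⟩ := exists_vandermonde_insert hkt
  have hterm : ∀ i ∈ s, vandermonde s (y ∘ Equiv.swap i k) *
        vandermonde (insert k t) (y ∘ Equiv.swap i k) =
      vandermonde s y * δ * vandermonde t y *
        ((Lagrange.nodal t y).eval (y i) * (Lagrange.basis s y i).eval (y k)) := by
    intro i hi
    have hit : i ∉ t := Finset.disjoint_left.1 hst hi
    have hz : ∀ l, l ≠ i → l ≠ k → (y ∘ Equiv.swap i k) l = y l := by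
      intro l h1 h2
      rw [Function.comp_apply, Equiv.swap_apply_of_ne_of_ne h1 h2]
    have hzi : (y ∘ Equiv.swap i k) i = y k := by simp
    have hzk : (y ∘ Equiv.swap i k) k = y i := by simp
    have hz1 : ∀ l ∈ s.erase i, (y ∘ Equiv.swap i k) l = y l := fun l hl =>
      hz l (Finset.ne_of_mem_erase hl) fun h => hks (h ▸ Finset.mem_of_mem_erase hl)
    have hz2 : ∀ l ∈ t, (y ∘ Equiv.swap i k) l = y l := fun l hl =>
      hz l (fun h => hit (h ▸ hl)) fun h => hkt (h ▸ hl)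
    obtain ⟨ε, h1⟩ := exists_vandermonde_insert (Finset.notMem_erase i s)
    rw [Finset.insert_erase hi] at h1
    have hb : (∏ l ∈ s.erase i, (y k - y l)) =
        (∏ l ∈ s.erase i, (y i - y l)) * (Lagrange.basis s y i).eval (y k) := by
      rw [Lagrange.basis, Polynomial.eval_prod, ← Finset.prod_mul_distrib]
      refine Finset.prod_congr rfl fun l hl => ?_
      have hne : y i - y l ≠ 0 := sub_ne_zero.2 fun h => Finset.ne_of_mem_erase hl (hy h).symm
      simp only [Lagrange.basisDivisor, Polynomial.eval_mul, Polynomial.eval_C,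
        Polynomial.eval_sub, Polynomial.eval_X]
      field_simp
    rw [h1, h1, h2, vandermonde_congr hz1, vandermonde_congr hz2, hzi, hzk,
      Finset.prod_congr rfl fun l hl => by rw [hz1 l hl], hb,
      Finset.prod_congr (s₁ := t) (g := fun l => y i - y l) rfl fun l hl => by rw [hz2 l hl],
      Lagrange.eval_nodal]
    ring
  have hint : (Lagrange.nodal t y).eval (y k) =
      ∑ i ∈ s, (Lagrange.nodal t y).eval (y i) * (Lagrange.basis s y i).eval (y k) := by
    conv_lhs => rw [Lagrange.eq_interpolate (s := s) (v := y) hy.injOn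
      (f := Lagrange.nodal t y) (by rw [Lagrange.degree_nodal]; exact_mod_cast hcard)]
    rw [Lagrange.interpolate_apply, Polynomial.eval_finsetSum]
    simp
  rw [Finset.sum_congr rfl hterm, ← Finset.mul_sum, ← hint, Lagrange.eval_nodal, h2]
  ring

variable [Fintype ι]

/-- The product of the Vandermonde products over the fibres of `col`. -/
def fiberVandermonde (col : ι → ℕ) (N : ℕ) (y : ι → ℂ) : ℂ :=
  ∏ c ∈ Finset.range N, vandermonde (Finset.univ.filter fun p => col p = c) y

theorem fiberVandermonde_ne_zero (col : ι → ℕ) (N : ℕ) {y : ι → ℂ} (hy : Function.Injective y) :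
    fiberVandermonde col N y ≠ 0 :=
  Finset.prod_ne_zero_iff.2 fun _ _ => vandermonde_ne_zero hy

/-- Integrality makes a vanishing sum of squares force every term to vanish. -/
theorem exists_int_fiberVandermonde (col : ι → ℕ) (N : ℕ) (y : ι → ℤ) :
    ∃ m : ℤ, fiberVandermonde col N (fun i => (y i : ℂ)) = m := by
  refine ⟨∏ c ∈ Finset.range N, ∏ p ∈ Finset.univ.filter fun p => col p = c,
    ∏ q ∈ Finset.univ.filter fun p => col p = c, if p < q then y q - y p else 1, ?_⟩
  push_cast
  rfl

theorem vandermonde_fiber_comp_swap_of_ne (col : ι → ℕ) {i k : ι} {c : ℕ} (hi : col i ≠ c)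
    (hk : col k ≠ c) (y : ι → ℂ) :
    vandermonde (Finset.univ.filter fun p => col p = c) (y ∘ Equiv.swap i k) =
      vandermonde (Finset.univ.filter fun p => col p = c) y := by
  refine vandermonde_congr fun p hp => ?_
  have hp := (Finset.mem_filter.1 hp).2
  rw [Function.comp_apply, Equiv.swap_apply_of_ne_of_ne]
  · rintro rfl; exact hi hp
  · rintro rfl; exact hk hp

theorem fiberVandermonde_comp_swap {col : ι → ℕ} {N : ℕ} {i k : ι} (hik : i ≠ k)
    (hcol : col i = col k) (hN : col k < N) (y : ι → ℂ) :
    fiberVandermonde col N (y ∘ Equiv.swap i k) = - fiberVandermonde col N y := by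
  have hmem : col k ∈ Finset.range N := Finset.mem_range.2 hN
  rw [fiberVandermonde, fiberVandermonde, ← Finset.mul_prod_erase _ _ hmem,
    ← Finset.mul_prod_erase _ _ hmem, vandermonde_comp_swap (by simpa using hcol) (by simp) hik,
    neg_mul]
  congr 2
  refine Finset.prod_congr rfl fun c hc => ?_
  have hne := (Finset.ne_of_mem_erase hc).symm
  exact vandermonde_fiber_comp_swap_of_ne col (hcol ▸ hne) hne y

/-- Only the columns `c` and `col k` are affected. Removing `k` from its column makes the inequality
of heights strict, as interpolation requires. -/
theorem sum_fiberVandermonde_comp_swap {col : ι → ℕ} {N : ℕ} {k : ι} {c : ℕ} (hc : c ≠ col k)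
    (hcN : c < N) (hN : col k < N)
    (hcard : (Finset.univ.filter fun p => col p = col k).card ≤
      (Finset.univ.filter fun p => col p = c).card) {y : ι → ℂ} (hy : Function.Injective y) :
    ∑ i ∈ Finset.univ.filter (fun p => col p = c),
      fiberVandermonde col N (y ∘ Equiv.swap i k) = fiberVandermonde col N y := by
  set s := Finset.univ.filter fun p => col p = c with hs
  have hk : k ∈ Finset.univ.filter fun p => col p = col k := by simp
  set t := (Finset.univ.filter fun p => col p = col k).erase k with ht
  have hins : (Finset.univ.filter fun p => col p = col k) = insert k t :=
    (Finset.insert_erase hk).symm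
  have hmem1 : c ∈ Finset.range N := Finset.mem_range.2 hcN
  have hmem2 : col k ∈ (Finset.range N).erase c :=
    Finset.mem_erase.2 ⟨hc.symm, Finset.mem_range.2 hN⟩
  have hsplit : ∀ z : ι → ℂ, fiberVandermonde col N z = vandermonde s z *
      vandermonde (insert k t) z * ∏ d ∈ ((Finset.range N).erase c).erase (col k),
        vandermonde (Finset.univ.filter fun p => col p = d) z := by
    intro z
    rw [fiberVandermonde, ← Finset.mul_prod_erase _ _ hmem1, ← Finset.mul_prod_erase _ _ hmem2,
      ← hins, ← hs, mul_assoc]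
  rw [hsplit y, ← sum_vandermonde_mul_vandermonde (s := s) (t := t) (k := k) _ _ _ _ hy,
    Finset.sum_mul]
  · refine Finset.sum_congr rfl fun i hi => ?_
    rw [hsplit]
    congr 1
    refine Finset.prod_congr rfl fun d hd => ?_
    have h1 := Finset.ne_of_mem_erase hd
    have h2 := Finset.ne_of_mem_erase (Finset.mem_of_mem_erase hd)
    have h3 := (Finset.mem_filter.1 hi).2
    exact vandermonde_fiber_comp_swap_of_ne col (by rw [h3]; exact h2.symm) h1.symm y
  · simp [hs, hc.symm]
  · simp [ht]
  · rw [Finset.disjoint_left]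
    intro p hp hp'
    have h1 := (Finset.mem_filter.1 hp).2
    have h2 := (Finset.mem_filter.1 (Finset.mem_of_mem_erase hp')).2
    exact hc (h1.symm.trans h2)
  · have := Finset.card_erase_add_one hk
    rw [← ht] at this
    omega

/-- Each earlier column lies wholly below `k` and contributes `+1` by interpolation; each earlier
element of the column of `k` contributes `-1` by antisymmetry. -/
theorem sum_lt_fiberVandermonde_comp_swap [LocallyFiniteOrderBot ι] {col : ι → ℕ} {N : ℕ}
    (hmono : ∀ i k, col i < col k → i < k) (hN : ∀ i, col i < N)
    (hcard : ∀ c k, c < col k → (Finset.univ.filter fun p => col p = col k).card ≤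
      (Finset.univ.filter fun p => col p = c).card) (k : ι) {y : ι → ℂ}
    (hy : Function.Injective y) :
    ∑ i ∈ Finset.Iio k, fiberVandermonde col N (y ∘ Equiv.swap i k) =
      ((col k : ℂ) - ((Finset.Iio k).filter fun i => col i = col k).card) *
        fiberVandermonde col N y := by
  have hmaps : ∀ i ∈ Finset.Iio k, col i ∈ Finset.range (col k + 1) := by
    intro i hi
    rw [Finset.mem_range]
    by_contra h
    exact (Finset.mem_Iio.1 hi).not_gt (hmono k i (by omega))
  rw [← Finset.sum_fiberwise_of_maps_to hmaps, Finset.sum_range_succ]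
  have h1 : ∀ c ∈ Finset.range (col k), ∑ i ∈ Finset.Iio k with col i = c,
      fiberVandermonde col N (y ∘ Equiv.swap i k) = fiberVandermonde col N y := by
    intro c hc
    have hc := Finset.mem_range.1 hc
    rw [← sum_fiberVandermonde_comp_swap hc.ne (hc.trans (hN k)) (hN k) (hcard c k hc) hy]
    refine Finset.sum_congr (Finset.ext fun i => ?_) fun _ _ => rfl
    simp only [Finset.mem_filter, Finset.mem_Iio, Finset.mem_univ, true_and]
    exact ⟨fun h => h.2, fun h => ⟨hmono i k (by omega), h⟩⟩
  have h2 : ∀ i ∈ (Finset.Iio k).filter (fun i => col i = col k),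
      fiberVandermonde col N (y ∘ Equiv.swap i k) = - fiberVandermonde col N y := by
    intro i hi
    rw [Finset.mem_filter, Finset.mem_Iio] at hi
    exact fiberVandermonde_comp_swap hi.1.ne hi.2 (hN k) y
  rw [Finset.sum_congr rfl h1, Finset.sum_congr rfl h2]
  simp only [Finset.sum_const, Finset.card_range, nsmul_eq_mul]
  ring

end Vandermonde

/-! ### The content eigenvalue equation for the column-reading tableau -/

namespace SYT

variable {n : ℕ} {μ : YoungDiagram}

theorem card_filter_column (T : SYT μ) (hμ : μ.card = n) (c : ℕ) :
    (Finset.univ.filter fun i : Fin n => (T.box i).2 = c).card = μ.colLen c := by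
  rw [YoungDiagram.colLen_eq_card]
  subst hμ
  refine Finset.card_bij (fun i _ => T.box i) ?_ ?_ ?_
  · intro i hi
    rw [YoungDiagram.mem_col_iff]
    exact ⟨T.box_mem i.2, (Finset.mem_filter.1 hi).2⟩
  · intro i _ j _ h
    exact Fin.ext (T.box_inj i.2 j.2 h)
  · intro b hb
    rw [YoungDiagram.mem_col_iff] at hb
    obtain ⟨k, hk, h, -⟩ := T.exists_box_eq hb.1
    exact ⟨⟨k, hk⟩, by simp [h, hb.2], h⟩

/-- Entries increase down a column, so the earlier boxes of the column are those above. -/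
theorem card_filter_Iio_column (T : SYT μ) (hμ : μ.card = n) (k : Fin n) :
    ((Finset.Iio k).filter fun i : Fin n => (T.box i).2 = (T.box k).2).card = (T.box k).1 := by
  subst hμ
  rw [← Finset.card_range (T.box k).1]
  refine Finset.card_bij (fun i _ => (T.box i).1) ?_ ?_ ?_
  · intro i hi
    rw [Finset.mem_filter, Finset.mem_Iio] at hi
    rw [Finset.mem_range]
    by_contra h
    have := T.le_of_box_le k.2 i.2 (by omega) hi.2.ge
    exact absurd hi.1 (not_lt.2 this)
  · intro i hi j hj h
    rw [Finset.mem_filter] at hi hj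
    exact Fin.ext (T.box_inj i.2 j.2 (Prod.ext h (hi.2.trans hj.2.symm)))
  · intro r hr
    rw [Finset.mem_range] at hr
    have hmem : (r, (T.box k).2) ∈ μ := μ.up_left_mem hr.le le_rfl (T.box_mem k.2)
    obtain ⟨l, hl, h, -⟩ := T.exists_box_eq hmem
    have hle : l ≤ k := T.le_of_box_le hl k.2 (by rw [h]; exact hr.le) (by rw [h])
    have hne : l ≠ k := by
      rintro rfl
      rw [h] at hr
      exact lt_irrefl _ hr
    refine ⟨⟨l, hl⟩, ?_, by simp [h]⟩
    rw [Finset.mem_filter, Finset.mem_Iio]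
    exact ⟨Fin.mk_lt_of_lt_val (lt_of_le_of_ne hle hne), by simp [h]⟩

/-- The product of the Vandermonde products over the columns of `T`. -/
def columnVandermonde (T : SYT μ) (n : ℕ) (y : Fin n → ℂ) : ℂ :=
  fiberVandermonde (fun i : Fin n => (T.box i).2) n y

theorem ColumnOrdered.sum_columnVandermonde_comp_swap {T : SYT μ} (hT : T.ColumnOrdered)
    (hμ : μ.card = n) (k : Fin n) {y : Fin n → ℂ} (hy : Function.Injective y) :
    ∑ i ∈ Finset.Iio k, T.columnVandermonde n (y ∘ Equiv.swap i k) =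
      (T.content k : ℂ) * T.columnVandermonde n y := by
  have h := sum_lt_fiberVandermonde_comp_swap (col := fun i : Fin n => (T.box i).2) (N := n)
    ?_ ?_ ?_ k hy
  · rw [T.card_filter_Iio_column hμ k] at h
    rw [columnVandermonde, content]
    push_cast
    exact h
  · intro i k hik
    by_contra hle
    rcases (not_lt.1 hle).eq_or_lt with rfl | hlt
    · exact lt_irrefl _ hik
    · have := hT k i hlt (hμ ▸ i.2)
      rw [Prod.Lex.toLex_lt_toLex] at this
      simp only at this hik
      omega
  · intro i
    have h1 := YoungDiagram.mem_iff_lt_rowLen.1 (T.box_mem (k := i) (hμ ▸ i.2))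
    exact h1.trans_le ((rowLen_le_card μ _).trans hμ.le)
  · intro c k hc
    rw [T.card_filter_column hμ, T.card_filter_column hμ]
    exact μ.colLen_anti _ _ hc.le

theorem columnVandermonde_ne_zero (T : SYT μ) {y : Fin n → ℂ} (hy : Function.Injective y) :
    T.columnVandermonde n y ≠ 0 :=
  fiberVandermonde_ne_zero _ _ hy

end SYT

/-! ### Jucys–Murphy elements and intertwiners -/

section JucysMurphy

variable {n : ℕ}

/-- The Jucys–Murphy element `∑ (i k)`, summed over `i < k`. -/
def jucysMurphy (k : Fin n) : MonoidAlgebra ℂ (Equiv.Perm (Fin n)) :=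
  ∑ i ∈ Finset.Iio k, MonoidAlgebra.single (Equiv.swap i k) 1

theorem coeff_jucysMurphy_mul (k : Fin n) (x : MonoidAlgebra ℂ (Equiv.Perm (Fin n)))
    (σ : Equiv.Perm (Fin n)) :
    (jucysMurphy k * x).coeff σ = ∑ i ∈ Finset.Iio k, x.coeff (Equiv.swap i k * σ) := by
  rw [jucysMurphy, Finset.sum_mul, MonoidAlgebra.coeff_sum, Finsupp.finsetSum_apply]
  refine Finset.sum_congr rfl fun i _ => ?_
  simp

theorem coeff_mul_jucysMurphy (k : Fin n) (x : MonoidAlgebra ℂ (Equiv.Perm (Fin n)))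
    (σ : Equiv.Perm (Fin n)) :
    (x * jucysMurphy k).coeff σ = ∑ i ∈ Finset.Iio k, x.coeff (σ * Equiv.swap i k) := by
  rw [jucysMurphy, Finset.mul_sum, MonoidAlgebra.coeff_sum, Finsupp.finsetSum_apply]
  refine Finset.sum_congr rfl fun i _ => ?_
  simp

/-- The transposition `(k l)` as an element of the group algebra. -/
abbrev transposition (k l : Fin n) : MonoidAlgebra ℂ (Equiv.Perm (Fin n)) :=
  MonoidAlgebra.single (Equiv.swap k l) 1

theorem transposition_mul_self (k l : Fin n) : transposition k l * transposition k l = 1 := by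
  rw [MonoidAlgebra.single_mul_single, Equiv.swap_mul_self, mul_one, MonoidAlgebra.one_def]

theorem Iio_eq_insert {k l : Fin n} (h : (l : ℕ) = k + 1) :
    Finset.Iio l = insert k (Finset.Iio k) := by
  ext i
  simp only [Finset.mem_Iio, Finset.mem_insert, Fin.lt_def, Fin.ext_iff]
  omega

theorem jucysMurphy_eq {k l : Fin n} (h : (l : ℕ) = k + 1) :
    jucysMurphy l = transposition k l + ∑ i ∈ Finset.Iio k, transposition i l := by
  rw [jucysMurphy, Iio_eq_insert h, Finset.sum_insert (by simp)]

/-- Conjugation by `(k l)` turns `(i l)` into `(i k)` for `i < k`; the remaining summand `(k l)`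
squares to `1`. -/
theorem transposition_mul_jucysMurphy_right {k l : Fin n} (h : (l : ℕ) = k + 1) :
    transposition k l * jucysMurphy l = 1 + jucysMurphy k * transposition k l := by
  rw [jucysMurphy_eq h, mul_add, transposition_mul_self, jucysMurphy, Finset.mul_sum,
    Finset.sum_mul]
  congr 1
  refine Finset.sum_congr rfl fun i hi => ?_
  have hi := Finset.mem_Iio.1 hi
  have hkl : k < l := Fin.lt_def.2 (by omega)
  rw [MonoidAlgebra.single_mul_single, MonoidAlgebra.single_mul_single,
    Equiv.mul_swap_eq_swap_mul, Equiv.swap_apply_right,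
    Equiv.swap_apply_of_ne_of_ne hi.ne (hi.trans hkl).ne]

theorem jucysMurphy_mul_transposition_right {k l : Fin n} (h : (l : ℕ) = k + 1) :
    jucysMurphy l * transposition k l = 1 + transposition k l * jucysMurphy k := by
  have h1 := congrArg (fun x => transposition k l * (x * transposition k l))
    (transposition_mul_jucysMurphy_right h)
  simp only [add_mul, mul_add, one_mul, mul_assoc, transposition_mul_self, mul_one] at h1
  rwa [← mul_assoc (transposition k l) (transposition k l), transposition_mul_self, one_mul] at h1

/-- As `k` and `l` are adjacent and differ from `m`, the exchange of `k` and `l` permutes the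
indices below `m`. -/
theorem transposition_commute_jucysMurphy {k l m : Fin n} (h : (l : ℕ) = k + 1) (hk : m ≠ k)
    (hl : m ≠ l) : transposition k l * jucysMurphy m = jucysMurphy m * transposition k l := by
  rw [jucysMurphy, Finset.mul_sum, Finset.sum_mul]
  refine Finset.sum_equiv (Equiv.swap k l) (fun i => ?_) fun i _ => ?_
  · have h1 := Fin.val_ne_of_ne hk
    have h2 := Fin.val_ne_of_ne hl
    simp only [Finset.mem_Iio, Equiv.swap_apply_def]
    split_ifs with h3 h4
    · subst h3; simp only [Fin.lt_def]; omega
    · subst h4; simp only [Fin.lt_def]; omega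
    · rfl
  · rw [MonoidAlgebra.single_mul_single, MonoidAlgebra.single_mul_single,
      Equiv.mul_swap_eq_swap_mul, Equiv.swap_apply_of_ne_of_ne hk hl]

/-- `x` is a joint eigenvector of the left and right multiplications by the Jucys–Murphy
elements. -/
def IsBiweight (a b : ℕ → ℤ) (x : MonoidAlgebra ℂ (Equiv.Perm (Fin n))) : Prop :=
  ∀ k : Fin n, jucysMurphy k * x = (a k : ℂ) • x ∧ x * jucysMurphy k = (b k : ℂ) • x

theorem two_le_abs_sub_ne {a b : ℤ} (hab : 2 ≤ |b - a|) :
    (b : ℂ) - a ≠ 0 ∧ ((b : ℂ) - a)⁻¹ * ((b : ℂ) - a)⁻¹ ≠ 1 := by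
  constructor
  · intro h
    have h1 : b - a = 0 := by exact_mod_cast h
    rw [h1] at hab
    norm_num at hab
  · rw [← mul_inv, Ne, inv_eq_one]
    intro h
    have h1 : (b - a) * (b - a) = 1 := by exact_mod_cast h
    have h2 := abs_mul_abs_self (b - a)
    nlinarith

/-- The intertwining operator `s - 1 / (a (k + 1) - a k)` exchanges two neighbouring joint
eigenvalues. -/
theorem intertwine {V : Type*} [AddCommGroup V] [Module ℂ V] (F : Fin n → Module.End ℂ V)
    (s : Module.End ℂ V) {p q : Fin n} (hpq : (q : ℕ) = p + 1) (hss : ∀ v, s (s v) = v)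
    (hp : ∀ v, F p (s v) = s (F q v) - v) (hq : ∀ v, F q (s v) = v + s (F p v))
    (hm : ∀ m, m ≠ p → m ≠ q → ∀ v, F m (s v) = s (F m v)) {a : ℕ → ℤ} {x : V} (hx0 : x ≠ 0)
    (hx : ∀ m, F m x = (a m : ℂ) • x) (ha : 2 ≤ |a q - a p|) :
    s x - ((a q : ℂ) - a p)⁻¹ • x ≠ 0 ∧
      ∀ m : Fin n, F m (s x - ((a q : ℂ) - a p)⁻¹ • x) =
        (a (Equiv.swap (p : ℕ) (p + 1) m) : ℂ) • (s x - ((a q : ℂ) - a p)⁻¹ • x) := by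
  obtain ⟨hd0, hd2⟩ := two_le_abs_sub_ne ha
  have hd1 := mul_inv_cancel₀ hd0
  set d : ℂ := ((a q : ℂ) - a p)⁻¹ with hd
  -- Rewriting the stray `x` from the commutation relation in this way reduces the eigenvalue
  -- equation to a polynomial identity in `d`.
  have hxd : x = (((a q : ℂ) - a p) * d) • x := by rw [hd1, one_smul]
  refine ⟨fun h => ?_, fun m => ?_⟩
  -- If the new vector vanished, `s` being an involution would force `d * d = 1`, which the gap of
  -- at least `2` excludes.
  · have h1 : s x = d • x := sub_eq_zero.1 h
    have h2 : x = (d * d) • x := by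
      calc x = s (s x) := (hss x).symm
        _ = (d * d) • x := by rw [h1, map_smul, h1, smul_smul]
    have h3 : (1 - d * d) • x = 0 := by rw [sub_smul, one_smul, ← h2, sub_self]
    rcases smul_eq_zero.1 h3 with h4 | h4
    · exact hd2 (sub_eq_zero.1 h4).symm
    · exact hx0 h4
  · by_cases hmp : m = p
    · subst hmp
      rw [Equiv.swap_apply_left, ← hpq, map_sub, hp, map_smul, hx, hx, map_smul]
      nth_rewrite 2 [hxd]
      module
    · by_cases hmq : m = q
      · subst hmq
        rw [hpq, Equiv.swap_apply_right, map_sub, hq, map_smul, hx, hx, map_smul]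
        nth_rewrite 1 [hxd]
        module
      · have h1 : (m : ℕ) ≠ p := fun h => hmp (Fin.ext h)
        have h2 : (m : ℕ) ≠ p + 1 := fun h => hmq (Fin.ext (h.trans hpq.symm))
        rw [Equiv.swap_apply_of_ne_of_ne h1 h2, map_sub, hm m hmp hmq, map_smul, hx, map_smul]
        module

theorem IsBiweight.exists_left {a b : ℕ → ℤ} {x : MonoidAlgebra ℂ (Equiv.Perm (Fin n))}
    (hx : IsBiweight a b x) (hx0 : x ≠ 0) {k : ℕ} (hk : k + 1 < n)
    (ha : 2 ≤ |a (k + 1) - a k|) :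
    ∃ z : MonoidAlgebra ℂ (Equiv.Perm (Fin n)), z ≠ 0 ∧
      IsBiweight (fun l => a (Equiv.swap k (k + 1) l)) b z := by
  let p : Fin n := ⟨k, by omega⟩
  let q : Fin n := ⟨k + 1, hk⟩
  have hpq : (q : ℕ) = p + 1 := rfl
  obtain ⟨h1, h2⟩ := intertwine (fun m => LinearMap.mulLeft ℂ (jucysMurphy m))
    (LinearMap.mulLeft ℂ (transposition p q)) hpq
    (fun v => by
      simp only [LinearMap.mulLeft_apply]
      rw [← mul_assoc, transposition_mul_self, one_mul])
    (fun v => by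
      simp only [LinearMap.mulLeft_apply]
      rw [← mul_assoc (transposition p q), transposition_mul_jucysMurphy_right hpq]
      noncomm_ring)
    (fun v => by
      simp only [LinearMap.mulLeft_apply]
      rw [← mul_assoc, jucysMurphy_mul_transposition_right hpq]
      noncomm_ring)
    (fun m hm1 hm2 v => by
      simp only [LinearMap.mulLeft_apply]
      rw [← mul_assoc, ← transposition_commute_jucysMurphy hpq hm1 hm2, mul_assoc])
    hx0 (fun m => (hx m).1) ha
  refine ⟨_, h1, fun m => ⟨h2 m, ?_⟩⟩
  rw [LinearMap.mulLeft_apply, sub_mul, mul_assoc, (hx m).2, smul_mul_assoc, (hx m).2,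
    mul_smul_comm, smul_sub, smul_comm (_⁻¹)]

theorem IsBiweight.exists_right {a b : ℕ → ℤ} {x : MonoidAlgebra ℂ (Equiv.Perm (Fin n))}
    (hx : IsBiweight a b x) (hx0 : x ≠ 0) {k : ℕ} (hk : k + 1 < n)
    (hb : 2 ≤ |b (k + 1) - b k|) :
    ∃ z : MonoidAlgebra ℂ (Equiv.Perm (Fin n)), z ≠ 0 ∧
      IsBiweight a (fun l => b (Equiv.swap k (k + 1) l)) z := by
  let p : Fin n := ⟨k, by omega⟩
  let q : Fin n := ⟨k + 1, hk⟩
  have hpq : (q : ℕ) = p + 1 := rfl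
  obtain ⟨h1, h2⟩ := intertwine (fun m => LinearMap.mulRight ℂ (jucysMurphy m))
    (LinearMap.mulRight ℂ (transposition p q)) hpq
    (fun v => by
      simp only [LinearMap.mulRight_apply]
      rw [mul_assoc, transposition_mul_self, mul_one])
    (fun v => by
      simp only [LinearMap.mulRight_apply]
      rw [mul_assoc v (jucysMurphy q), jucysMurphy_mul_transposition_right hpq]
      noncomm_ring)
    (fun v => by
      simp only [LinearMap.mulRight_apply]
      rw [mul_assoc, transposition_mul_jucysMurphy_right hpq]
      noncomm_ring)
    (fun m hm1 hm2 v => by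
      simp only [LinearMap.mulRight_apply]
      rw [mul_assoc, transposition_commute_jucysMurphy hpq hm1 hm2, mul_assoc])
    hx0 (fun m => (hx m).2) hb
  refine ⟨_, h1, fun m => ⟨?_, h2 m⟩⟩
  rw [LinearMap.mulRight_apply, mul_sub, ← mul_assoc, (hx m).1, mul_smul_comm, (hx m).1,
    smul_mul_assoc, smul_sub, smul_comm (_⁻¹)]

theorem IsBiweight.congr {a b a' b' : ℕ → ℤ} {x : MonoidAlgebra ℂ (Equiv.Perm (Fin n))}
    (hx : IsBiweight a b x) (ha : ∀ k < n, a k = a' k) (hb : ∀ k < n, b k = b' k) :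
    IsBiweight a' b' x := fun k => by
  rw [← ha k k.2, ← hb k k.2]
  exact hx k

end JucysMurphy

/-! ### Joint eigenvectors for all pairs of tableaux of one shape -/

namespace SYT

variable {n : ℕ} {μ : YoungDiagram}

theorem content_swap (T : SYT μ) (k : ℕ) (hk : k + 1 < μ.card)
    (h1 : (T.box k).1 ≠ (T.box (k + 1)).1) (h2 : (T.box k).2 ≠ (T.box (k + 1)).2) {l : ℕ}
    (hl : l < μ.card) :
    (T.swap k hk h1 h2).content l = T.content (Equiv.swap k (k + 1) l) := by
  rw [content, box_swap _ _ _ _ _ hl, content]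

/-- Using the inverse permutation in `u` and the permutation itself in `v` converts left and right
multiplication by `(i k)` into the same exchange of arguments of the column Vandermonde product. -/
theorem exists_isBiweight_of_columnOrdered {T : SYT μ} (hT : T.ColumnOrdered)
    (hμ : μ.card = n) :
    ∃ x : MonoidAlgebra ℂ (Equiv.Perm (Fin n)), x ≠ 0 ∧ IsBiweight T.content T.content x := by
  let y : Fin n → ℂ := fun i => ((i : ℕ) : ℂ)
  have hy : Function.Injective y := fun i j h => Fin.ext (Nat.cast_injective h)
  let u : MonoidAlgebra ℂ (Equiv.Perm (Fin n)) :=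
    MonoidAlgebra.ofCoeff (Finsupp.equivFunOnFinite.symm fun σ =>
      T.columnVandermonde n (y ∘ (σ⁻¹ : Equiv.Perm (Fin n))))
  let v : MonoidAlgebra ℂ (Equiv.Perm (Fin n)) :=
    MonoidAlgebra.ofCoeff (Finsupp.equivFunOnFinite.symm fun σ =>
      T.columnVandermonde n (y ∘ σ))
  have hu : ∀ σ, u.coeff σ = T.columnVandermonde n (y ∘ (σ⁻¹ : Equiv.Perm (Fin n))) :=
    fun _ => rfl
  have hv : ∀ σ, v.coeff σ = T.columnVandermonde n (y ∘ σ) := fun _ => rfl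
  have hju : ∀ k : Fin n, jucysMurphy k * u = (T.content k : ℂ) • u := by
    intro k
    refine MonoidAlgebra.ext (Finsupp.ext fun σ => ?_)
    rw [coeff_jucysMurphy_mul, MonoidAlgebra.coeff_smul_apply, smul_eq_mul, hu,
      ← hT.sum_columnVandermonde_comp_swap hμ k (hy.comp (Equiv.injective _))]
    refine Finset.sum_congr rfl fun i _ => ?_
    rw [hu, mul_inv_rev, Equiv.swap_inv]
    rfl
  have hjv : ∀ k : Fin n, v * jucysMurphy k = (T.content k : ℂ) • v := by
    intro k
    refine MonoidAlgebra.ext (Finsupp.ext fun σ => ?_)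
    rw [coeff_mul_jucysMurphy, MonoidAlgebra.coeff_smul_apply, smul_eq_mul, hv,
      ← hT.sum_columnVandermonde_comp_swap hμ k (hy.comp (Equiv.injective _))]
    rfl
  refine ⟨u * v, fun h0 => ?_, fun k => ⟨?_, ?_⟩⟩
  · have hint : ∀ σ : Equiv.Perm (Fin n), ∃ m : ℤ, T.columnVandermonde n (y ∘ σ) = m := fun σ =>
      exists_int_fiberVandermonde _ _ (fun i => ((σ i : ℕ) : ℤ))
    choose m hm using hint
    have h1 : (u * v).coeff 1 = 0 := by rw [h0]; rfl
    rw [MonoidAlgebra.coeff_mul_apply_left, Finsupp.sum_fintype _ _ (by simp)] at h1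
    -- The coefficient at `1` pairs `u` at `σ` with `v` at `σ⁻¹`, and these two values coincide.
    have h2 : ∑ σ : Equiv.Perm (Fin n), m σ⁻¹ * m σ⁻¹ = 0 := by
      simp only [hu, hv, mul_one, hm] at h1
      exact_mod_cast h1
    rw [Finset.sum_eq_zero_iff_of_nonneg fun σ _ => mul_self_nonneg _] at h2
    have h3 := mul_self_eq_zero.1 (h2 1 (Finset.mem_univ _))
    have h4 := hm 1⁻¹
    rw [h3, Int.cast_zero] at h4
    exact T.columnVandermonde_ne_zero (hy.comp (Equiv.injective _)) h4
  · rw [← mul_assoc, hju, smul_mul_assoc]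
  · rw [mul_assoc, hjv, mul_smul_comm]

theorem two_le_abs_content_sub (T : SYT μ) {k : ℕ} (h1 : (T.box k).1 < (T.box (k + 1)).1)
    (h2 : (T.box (k + 1)).2 < (T.box k).2) : 2 ≤ |T.content k - T.content (k + 1)| := by
  refine le_trans ?_ (le_abs_self _)
  simp only [content]
  lia

/-- Both tableaux are moved to the column-ordered one; the intertwiners on the two sides then undo
the exchanges. At a descent the contents differ by at least `2`, so no vector is lost. -/
theorem exists_isBiweight (hμ : μ.card = n) (T S : SYT μ) :
    ∃ x : MonoidAlgebra ℂ (Equiv.Perm (Fin n)), x ≠ 0 ∧ IsBiweight T.content S.content x := by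
  subst hμ
  induction T using induction_descent with
  | h0 T hT =>
    induction S using induction_descent with
    | h0 S hS =>
      rw [hT.unique hS]
      exact exists_isBiweight_of_columnOrdered hS rfl
    | hs S k hk h1 h2 ih =>
      obtain ⟨x, hx0, hx⟩ := ih
      obtain ⟨z, hz0, hz⟩ := hx.exists_right hx0 (k := k) hk (by
        rw [content_swap _ _ _ _ _ hk, content_swap _ _ _ _ _ (by omega), Equiv.swap_apply_left,
          Equiv.swap_apply_right]
        exact S.two_le_abs_content_sub h1 h2)
      refine ⟨z, hz0, hz.congr (fun _ _ => rfl) fun l hl => ?_⟩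
      rw [content_swap, Equiv.swap_apply_self]
      simp only [Equiv.swap_apply_def]
      split_ifs <;> omega
  | hs T k hk h1 h2 ih =>
    obtain ⟨x, hx0, hx⟩ := ih
    obtain ⟨z, hz0, hz⟩ := hx.exists_left hx0 (k := k) hk (by
      rw [content_swap _ _ _ _ _ hk, content_swap _ _ _ _ _ (by omega), Equiv.swap_apply_left,
        Equiv.swap_apply_right]
      exact T.two_le_abs_content_sub h1 h2)
    refine ⟨z, hz0, hz.congr (fun l hl => ?_) fun _ _ => rfl⟩
    rw [content_swap, Equiv.swap_apply_self]
    simp only [Equiv.swap_apply_def]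
    split_ifs <;> omega

end SYT

/-! ### Linear algebra of joint eigenvectors and eigenbases -/

section JointEigenvectors

variable {ι κ V : Type*} [AddCommGroup V] [Module ℂ V]

theorem linearIndependent_of_joint_eigenvectors (F : κ → Module.End ℂ V) (χ : ι → κ → ℂ)
    (hχ : Function.Injective χ) (v : ι → V) (hv : ∀ i, v i ≠ 0)
    (h : ∀ i k, F k (v i) = χ i k • v i) : LinearIndependent ℂ v := by
  classical
  rw [linearIndependent_iff']
  intro s
  induction s using Finset.induction_on with
  | empty => simp
  | insert a s ha ih =>
    intro g hg
    have hs : ∀ i ∈ s, g i = 0 := by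
      intro i hi
      have hne : χ i ≠ χ a := fun he => ha (hχ he ▸ hi)
      obtain ⟨k, hk⟩ := Function.ne_iff.1 hne
      -- Applying `F k - χ a k` to the relation kills the term of `a` and keeps a nonzero factor at
      -- `i`.
      have h1 : ∑ j ∈ s, (g j * (χ j k - χ a k)) • v j = 0 := by
        have h2 := congrArg (fun x => F k x - χ a k • x) hg
        simp only [map_sum, map_smul, h, Finset.smul_sum, map_zero, smul_zero, sub_zero] at h2
        rw [← Finset.sum_sub_distrib, Finset.sum_insert ha] at h2
        rw [← h2]
        have h3 : g a • χ a k • v a - χ a k • g a • v a = 0 := by rw [smul_comm, sub_self]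
        rw [h3, zero_add]
        refine Finset.sum_congr rfl fun j _ => ?_
        module
      rcases mul_eq_zero.1 (ih _ h1 i hi) with h2 | h2
      · exact h2
      · exact absurd (sub_eq_zero.1 h2) hk
    have hga : g a = 0 := by
      rw [Finset.sum_insert ha, Finset.sum_eq_zero fun i hi => by rw [hs i hi, zero_smul],
        add_zero] at hg
      exact (smul_eq_zero.1 hg).resolve_right (hv a)
    intro i hi
    rcases Finset.mem_insert.1 hi with rfl | hi
    · exact hga
    · exact hs i hi

variable [Fintype ι]

theorem charpoly_roots_of_eigenbasis [Module.Finite ℂ V] (b : Module.Basis ι ℂ V)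
    {f : Module.End ℂ V} {d : ι → ℂ} (hf : ∀ i, f (b i) = d i • b i) :
    f.charpoly.roots = Finset.univ.val.map d := by
  classical
  have hm : LinearMap.toMatrix b b f = Matrix.diagonal d := by
    ext i j
    rw [LinearMap.toMatrix_apply, hf, map_smul, Module.Basis.repr_self, Finsupp.smul_single,
      smul_eq_mul, mul_one, Finsupp.single_apply, Matrix.diagonal_apply]
    by_cases h : i = j
    · simp [h]
    · simp [h, Ne.symm h]
  rw [← LinearMap.charpoly_toMatrix f b, hm, Matrix.charpoly_diagonal,
    ← Polynomial.roots_multiset_prod_X_sub_C (Finset.univ.val.map d), Multiset.map_map]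
  rfl

theorem finrank_eigenspace_of_eigenbasis (b : Module.Basis ι ℂ V) {f : Module.End ℂ V}
    {d : ι → ℂ} (hf : ∀ i, f (b i) = d i • b i) (β : ℂ) :
    Module.finrank ℂ (f.eigenspace β) = (Finset.univ.filter fun i => d i = β).card := by
  have hs : f.eigenspace β = Submodule.span ℂ (b '' {i | d i = β}) := by
    ext x
    rw [Module.End.mem_eigenspace_iff, Module.Basis.mem_span_image]
    have hrepr : ∀ i, b.repr (f x) i = d i * b.repr x i := by
      intro i
      have h := congrArg (fun y => b.repr (f y) i) (b.sum_repr x)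
      simp only [map_sum, map_smul, hf, Finsupp.finsetSum_apply, Finsupp.smul_apply,
        Module.Basis.repr_self, smul_eq_mul] at h
      rw [← h, Finset.sum_eq_single i]
      · simp [mul_comm]
      · intro j _ hj
        simp [Finsupp.single_eq_of_ne hj.symm]
      · simp
    constructor
    · intro h i hi
      have h1 := hrepr i
      rw [h, map_smul, Finsupp.smul_apply, smul_eq_mul] at h1
      exact (mul_right_cancel₀ (Finsupp.mem_support_iff.1 hi) h1).symm
    · intro h
      refine b.repr.injective (Finsupp.ext fun i => ?_)
      rw [hrepr, map_smul, Finsupp.smul_apply, smul_eq_mul]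
      by_cases hi : b.repr x i = 0
      · rw [hi, mul_zero, mul_zero]
      · have : d i = β := h (Finsupp.mem_support_iff.2 hi)
        rw [this]
  rw [hs, Set.image_eq_range, finrank_span_eq_card]
  · rw [Fintype.card_subtype]
    rfl
  · exact b.linearIndependent.comp _ Subtype.val_injective

end JointEigenvectors

/-! ### Diagonalisation of the shuffle -/

section Shuffle

variable {n : ℕ}

/-- For a fixed larger index `k`, the proper transpositions make up the Jucys–Murphy element and the
pair `(k, k)` supplies the `1`. -/
theorem shuffleElement_eq_sum : shuffleElement n =
    ∑ k : Fin n, ((1 / (n : ℂ)) * (1 / ((k : ℕ) + 1 : ℂ))) • (jucysMurphy k + 1) := by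
  have h : ∀ σ : Equiv.Perm (Fin n), MonoidAlgebra.single σ ((shuffle n σ : ℝ) : ℂ) =
      ∑ j : Fin n, ∑ i ∈ Finset.Iic j, if Equiv.swap i j = σ then
        MonoidAlgebra.single σ ((1 / (n : ℂ)) * (1 / ((j : ℕ) + 1 : ℂ))) else 0 := by
    intro σ
    refine MonoidAlgebra.ext (Finsupp.ext fun τ => ?_)
    simp only [shuffle, Complex.ofReal_sum, MonoidAlgebra.coeff_sum, Finsupp.finsetSum_apply,
      MonoidAlgebra.coeff_single, Finsupp.single_apply]
    by_cases hτ : σ = τ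
    · simp only [hτ, if_true]
      refine Finset.sum_congr rfl fun j _ => Finset.sum_congr rfl fun i _ => ?_
      split_ifs <;> simp
    · simp only [hτ, if_false]
      symm
      refine Finset.sum_eq_zero fun j _ => Finset.sum_eq_zero fun i _ => ?_
      split_ifs <;> simp [hτ]
  rw [shuffleElement, Finset.sum_congr rfl fun σ _ => h σ, Finset.sum_comm]
  refine Finset.sum_congr rfl fun j _ => ?_
  rw [Finset.sum_comm, ← Finset.Iio_insert, Finset.sum_insert (by simp), smul_add, add_comm,
    jucysMurphy, Finset.smul_sum]
  congr 1
  · refine Finset.sum_congr rfl fun i _ => ?_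
    rw [Finset.sum_ite_eq, if_pos (Finset.mem_univ _), MonoidAlgebra.smul_single, smul_eq_mul,
      mul_one]
  · rw [Finset.sum_ite_eq, if_pos (Finset.mem_univ _), Equiv.swap_self, MonoidAlgebra.one_def,
      MonoidAlgebra.smul_single, smul_eq_mul, mul_one]
    rfl

theorem shuffleOperator_apply_of_isBiweight {μ : YoungDiagram} (hμ : μ.card = n) (T : SYT μ)
    {a : ℕ → ℤ} {x : MonoidAlgebra ℂ (Equiv.Perm (Fin n))} (hx : IsBiweight T.content a x) :
    shuffleOperator n x = ((eig T : ℝ) : ℂ) • x := by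
  rw [shuffleOperator, LinearMap.mulLeft_apply, shuffleElement_eq_sum, Finset.sum_mul,
    T.eig_eq_sum_content, hμ, Finset.sum_range]
  push_cast
  rw [Finset.mul_sum, Finset.sum_smul]
  refine Finset.sum_congr rfl fun k _ => ?_
  rw [smul_mul_assoc, add_mul, (hx k).1, one_mul]
  module

/-- The pairs of standard tableaux of the same shape with `n` boxes. -/
abbrev TableauPair (n : ℕ) : Type := Σ μ : Shape n, SYT μ.1 × SYT μ.1

theorem card_tableauPair (n : ℕ) : Fintype.card (TableauPair n) = n.factorial := by
  rw [← sum_dim_sq, Fintype.card_sigma]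
  refine Finset.sum_congr rfl fun μ _ => ?_
  rw [Fintype.card_prod, ← Nat.card_eq_fintype_card, dim, sq]

/-- Left and right contents together separate the pairs, which gives independence; the number of
pairs is the dimension `n!`. -/
theorem exists_eigenbasis (n : ℕ) :
    ∃ b : Module.Basis (TableauPair n) ℂ (MonoidAlgebra ℂ (Equiv.Perm (Fin n))),
      ∀ i, shuffleOperator n (b i) = ((eig i.2.1 : ℝ) : ℂ) • b i := by
  choose x hx0 hx using fun i : TableauPair n => SYT.exists_isBiweight i.1.2 i.2.1 i.2.2
  have hli : LinearIndependent ℂ x := by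
    refine linearIndependent_of_joint_eigenvectors
      (fun k : Fin n ⊕ Fin n => k.elim (fun k => LinearMap.mulLeft ℂ (jucysMurphy k))
        (fun k => LinearMap.mulRight ℂ (jucysMurphy k)))
      (fun i k => k.elim (fun k => (i.2.1.content k : ℂ)) (fun k => (i.2.2.content k : ℂ)))
      ?_ x hx0 ?_
    · rintro ⟨⟨μ, hμ⟩, T, S⟩ ⟨⟨ν, hν⟩, T', S'⟩ h
      have hT : ∀ k < μ.card, T.content k = T'.content k := fun k hk => by
        have h1 : (T.content k : ℂ) = T'.content k := congrFun h (Sum.inl ⟨k, hμ ▸ hk⟩)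
        exact_mod_cast h1
      have hS : ∀ k < μ.card, S.content k = S'.content k := fun k hk => by
        have h1 : (S.content k : ℂ) = S'.content k := congrFun h (Sum.inr ⟨k, hμ ▸ hk⟩)
        exact_mod_cast h1
      obtain rfl := T.shape_eq_of_content_eq T' (hμ.trans hν.symm) hT
      rw [SYT.eq_of_content_eq hT, SYT.eq_of_content_eq hS]
    · rintro i (k | k)
      · exact (hx i k).1
      · exact (hx i k).2
  have hcard : Fintype.card (TableauPair n) =
      Module.finrank ℂ (MonoidAlgebra ℂ (Equiv.Perm (Fin n))) := by
    rw [card_tableauPair, (MonoidAlgebra.coeffLinearEquiv ℂ).finrank_eq,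
      Module.finrank_finsupp_self, Fintype.card_perm, Fintype.card_fin]
  have : Nonempty (TableauPair n) :=
    Fintype.card_pos_iff.1 (by rw [card_tableauPair]; exact n.factorial_pos)
  refine ⟨basisOfLinearIndependentOfCardEqFinrank hli hcard, fun i => ?_⟩
  rw [coe_basisOfLinearIndependentOfCardEqFinrank]
  exact shuffleOperator_apply_of_isBiweight i.1.2 i.2.1 (hx i)

theorem dim_pos {μ : YoungDiagram} (T : SYT μ) : 0 < dim μ :=
  Nat.card_pos_iff.2 ⟨⟨T⟩, inferInstance⟩

/-- Forgetting the second tableau of a pair has fibres of size `dim`. -/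
theorem sum_tableauPair {M : Type*} [AddCommMonoid M] (f : Tableau n → M) :
    ∑ i : TableauPair n, f ⟨i.1, i.2.1⟩ = ∑ T : Tableau n, dim T.1.1 • f T := by
  have h : (Finset.univ : Finset (Tableau n)) = Finset.univ.sigma fun _ => Finset.univ := by
    ext; simp
  rw [Fintype.sum_sigma, h, Finset.sum_sigma]
  refine Finset.sum_congr rfl fun μ _ => ?_
  rw [Fintype.sum_prod_type]
  refine Finset.sum_congr rfl fun T _ => ?_
  change ∑ _ : SYT μ.1, f ⟨μ, T⟩ = _
  rw [Finset.sum_const, Finset.card_univ, ← Nat.card_eq_fintype_card, dim]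

end Shuffle

end

end OneSidedShuffle

theorem theorem1p5 (n : ℕ) (hn : 1 ≤ n) :
    -- the eigenvalues are exactly the numbers `eig T`
    (∀ β : ℂ, (OneSidedShuffle.shuffleOperator n).HasEigenvalue β ↔
      ∃ T : OneSidedShuffle.Tableau n, ((OneSidedShuffle.eig T.2 : ℝ) : ℂ) = β) ∧
    -- algebraic multiplicities: each `T` of shape `μ` contributes its eigenvalue `d_μ` times
    (OneSidedShuffle.shuffleOperator n).charpoly.roots =
      ∑ T : OneSidedShuffle.Tableau n,
        Multiset.replicate (OneSidedShuffle.dim T.1.1) ((OneSidedShuffle.eig T.2 : ℝ) : ℂ) ∧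
    -- geometric multiplicities
    (∀ β : ℂ, Module.finrank ℂ ((OneSidedShuffle.shuffleOperator n).eigenspace β) =
      ∑ T : OneSidedShuffle.Tableau n with ((OneSidedShuffle.eig T.2 : ℝ) : ℂ) = β,
        OneSidedShuffle.dim T.1.1) := by
  classical
  obtain ⟨b, hb⟩ := OneSidedShuffle.exists_eigenbasis n
  have hrank : ∀ β : ℂ, Module.finrank ℂ ((OneSidedShuffle.shuffleOperator n).eigenspace β) =
      ∑ T : OneSidedShuffle.Tableau n with ((OneSidedShuffle.eig T.2 : ℝ) : ℂ) = β,
        OneSidedShuffle.dim T.1.1 := by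
    intro β
    rw [OneSidedShuffle.finrank_eigenspace_of_eigenbasis b hb, Finset.card_filter,
      Finset.sum_filter]
    refine (OneSidedShuffle.sum_tableauPair fun T =>
      if ((OneSidedShuffle.eig T.2 : ℝ) : ℂ) = β then 1 else 0).trans ?_
    refine Finset.sum_congr rfl fun T _ => ?_
    split_ifs <;> simp
  refine ⟨fun β => ?_, ?_, hrank⟩
  -- Every `T` contributes a positive dimension, so an eigenspace is nonzero exactly when some `T`
  -- has the given eigenvalue.
  · have := Module.Finite.of_basis b
    rw [Module.End.hasEigenvalue_iff, ← Submodule.one_le_finrank_iff, hrank,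
      Nat.one_le_iff_ne_zero, Ne, Finset.sum_eq_zero_iff]
    constructor
    · intro h
      push Not at h
      obtain ⟨T, hT, -⟩ := h
      exact ⟨T, (Finset.mem_filter.1 hT).2⟩
    · rintro ⟨T, hT⟩ h
      exact (OneSidedShuffle.dim_pos T.2).ne' (h T (Finset.mem_filter.2 ⟨Finset.mem_univ _, hT⟩))
  · have := Module.Finite.of_basis b
    rw [OneSidedShuffle.charpoly_roots_of_eigenbasis b hb]
    have h := OneSidedShuffle.sum_tableauPair fun T : OneSidedShuffle.Tableau n =>
      ({((OneSidedShuffle.eig T.2 : ℝ) : ℂ)} : Multiset ℂ)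
    simp only [Multiset.nsmul_singleton] at h
    rw [← h, Finset.sum, ← Multiset.sum_map_singleton (Multiset.map _ _), Multiset.map_map]
    rfl
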